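/- Let $k$ be a field, $X$ an indeterminate, $L=k((X))$, and let $R=k[[X^3,X^4,X^5]]\subseteq L$, $R_1=k[[X^2,X^3]]$, $R_2=k[[X]]$. For a subring $A$ of $L$ and an $A$-submodule $E$ of $L$ put $(A:E)=\{x\in L: xE\subseteq A\}$ and $E_v=(A:(A:E))$. Call a domain $A$ with quotient field $L$ *divisorial* if $I_v=I$ for every nonzero fractional ideal $I$ of $A$, and an *fgv domain* if $I_v=I$ for every nonzero finitely generated fractional ideal $I$ of $A$. Let $O(R)$ be the set of overrings of $R$, i.e. of the rings $T$ with $R\subseteq T\subseteq L$. A *semistar operation* on $R$ is a map $E\mapsto E^*$ from the set of nonzero $R$-submodules of $L$ to itself such that for all nonzero $a\in L$ and all nonzero $R$-submodules $E,F$ of $L$: $(aE)^*=aE^*$; $E\subseteq F$ implies $E^*\subseteq F^*$; $E\subseteq E^*$ and $(E^*)^*=E^*$. It is of *finite character* if $E^*=\bigcup F^*$ for every $E$, where $F$ runs over the nonzero finitely generated $R$-submodules of $E$. Let $SSFc(R)$ be the set of semistar operations of finite character on $R$. Then: 1. $R$ is a one-dimensional Noetherian local domain with quotient field $L$, and $R$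 is not divisorial. 2. $R\subsetneq R_1\subsetneq R_2\subsetneq L$ and $O(R)=\{R,R_1,R_2,L\}$; moreover $R_2$ is the integral closure of $R$ in $L$, and every overring of $R$ other than $R$ is divisorial and an fgv domain. Thus $|O(R)|=4=3+\dim R$. 3. $SSFc(R)=\{e,\ \bar d,\ \overline{*_{R_1}},\ \bar t,\ *_{R_1},\ *_{R_2}\}$, where, for every nonzero $R$-submodule $E$ of $L$, $E^{e}=L$, $E^{\bar d}=E$, $E^{\overline{*_{R_1}}}=ER_1\cap E_v$, $E^{\bar t}=\bigcup F_v$ over the nonzero finitely generated $R$-submodules $F$ of $E$, and $E^{*_{R_i}}=ER_i$ for $i=1,2$ (here $E_v$ and $F_v$ are formed with respect to $R$). These six operations are distinct, so $|SSFc(R)|=6=5+\dim R$. -/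

import Mathlib

open scoped Pointwise LaurentSeries

universe u

section Semistar

variable {K : Type u} [Field K]

/-- The set `O(R)` of overrings of `R`: the rings between `R` and `K`
(`K` is the quotient field of `R` in all uses). -/
def overrings (R : Subring K) : Set (Subring K) := {T | R ≤ T}

/-- The set of nonzero `R`-submodules of `K`. -/
abbrev NonzeroSubmodule (R : Subring K) : Type u := {E : Submodule R K // E ≠ ⊥}

/-- The divisorial closure `E_v = (R : (R : E))`, where `(R : E) = {x ∈ K | x E ⊆ R}`. -/
def vClosure (R : Subring K) (E : Submodule R K) : Submodule R K := 1 / (1 / E)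

/-- A domain `R` with quotient field `K` is divisorial if `I_v = I` for every nonzero fractional
ideal `I` of `R`. -/
def IsDivisorialDomain (R : Subring K) : Prop :=
  ∀ I : Submodule R K, I ≠ ⊥ → IsFractional (nonZeroDivisors R) I → vClosure R I = I

/-- A domain `R` with quotient field `K` is an fgv domain if `I_v = I` for every nonzero finitely
generated fractional ideal `I` of `R`. -/
def IsFgvDomain (R : Subring K) : Prop :=
  ∀ I : Submodule R K, I ≠ ⊥ → I.FG → vClosure R I = I

theorem smul_ne_bot {R : Subring K} {a : K} (ha : a ≠ 0) {E : Submodule R K} (hE : E ≠ ⊥) :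
    a • E ≠ ⊥ := by
  obtain ⟨x, hx, hx0⟩ := (Submodule.ne_bot_iff E).1 hE
  exact (Submodule.ne_bot_iff _).2
    ⟨a * x, Submodule.smul_mem_pointwise_smul x a E hx, mul_ne_zero ha hx0⟩

theorem ne_bot_of_le {R : Subring K} {E F : Submodule R K} (hE : E ≠ ⊥) (h : E ≤ F) : F ≠ ⊥ :=
  fun hF => hE (le_bot_iff.1 (hF ▸ h))

/-- The module `aE`, for `a ≠ 0`. -/
def NonzeroSubmodule.scale {R : Subring K} (a : K) (ha : a ≠ 0) (E : NonzeroSubmodule R) :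
    NonzeroSubmodule R := ⟨a • E.1, smul_ne_bot ha E.2⟩

/-- A semistar operation on `R`: a closure operation on the nonzero `R`-submodules of `K` which
commutes with multiplication by the nonzero elements of `K`. -/
@[ext]
structure SemistarOperation (R : Subring K) where
  toFun : NonzeroSubmodule R → NonzeroSubmodule R
  map_scale : ∀ (a : K) (ha : a ≠ 0) (E : NonzeroSubmodule R),
    toFun (E.scale a ha) = (toFun E).scale a ha
  monotone : ∀ E F : NonzeroSubmodule R, E ≤ F → toFun E ≤ toFun F
  le_closure : ∀ E : NonzeroSubmodule R, E ≤ toFun E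
  idempotent : ∀ E : NonzeroSubmodule R, toFun (toFun E) = toFun E

/-- Finite character: `E^* = ⋃ F^*`, over the nonzero finitely generated `F ⊆ E`. -/
def SemistarOperation.IsFiniteCharacter {R : Subring K} (s : SemistarOperation R) : Prop :=
  ∀ (E : NonzeroSubmodule R) (x : K), x ∈ (s.toFun E).1 ↔
    ∃ F : NonzeroSubmodule R, (F.1.FG ∧ F ≤ E) ∧ x ∈ (s.toFun F).1

/-- `SSFc(R)`: the set of semistar operations of finite character on `R`. -/
def SSFc (R : Subring K) : Set (SemistarOperation R) := {s | s.IsFiniteCharacter}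

/-- A monotone, extensive, idempotent operation `c` on submodules with `a E^c ⊆ (aE)^c` for all
`a ≠ 0` restricts to a semistar operation. -/
def SemistarOperation.ofClosure {R : Subring K} (c : Submodule R K → Submodule R K)
    (hscale : ∀ (a : K), a ≠ 0 → ∀ E : Submodule R K, E ≠ ⊥ → a • c E ≤ c (a • E))
    (hmono : ∀ E F : Submodule R K, E ≠ ⊥ → E ≤ F → c E ≤ c F)
    (hle : ∀ E : Submodule R K, E ≠ ⊥ → E ≤ c E)
    (hidem : ∀ E : Submodule R K, E ≠ ⊥ → c (c E) ≤ c E) : SemistarOperation R where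
  toFun E := ⟨c E.1, ne_bot_of_le E.2 (hle E.1 E.2)⟩
  map_scale a ha E := by
    apply Subtype.ext
    apply le_antisymm
    · change c (a • E.1) ≤ a • c E.1
      have h := hscale a⁻¹ (inv_ne_zero ha) (a • E.1) (smul_ne_bot ha E.2)
      rw [smul_smul, inv_mul_cancel₀ ha, one_smul] at h
      have h2 := Submodule.map_mono (f := DistribSMul.toLinearMap R K a) h
      change a • (a⁻¹ • c (a • E.1)) ≤ a • c E.1 at h2
      rwa [smul_smul, mul_inv_cancel₀ ha, one_smul] at h2
    · exact hscale a ha E.1 E.2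
  monotone E F h := hmono E.1 F.1 E.2 h
  le_closure E := hle E.1 E.2
  idempotent E := Subtype.ext (le_antisymm (hidem E.1 E.2)
    (hle _ (ne_bot_of_le E.2 (hle E.1 E.2))))

theorem mem_vClosure {R : Subring K} {E : Submodule R K} {x : K} :
    x ∈ vClosure R E ↔ ∀ y : K, (∀ e ∈ E, y * e ∈ R) → x * y ∈ R := by
  have h1 : ∀ z : K, z ∈ (1 : Submodule R K) ↔ z ∈ R := by
    intro z
    rw [Submodule.mem_one]
    exact ⟨fun ⟨y, hy⟩ => hy ▸ y.2, fun h => ⟨⟨z, h⟩, rfl⟩⟩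
  simp only [vClosure, Submodule.mem_div_iff_forall_mul_mem, h1]

theorem vClosure_mono {R : Subring K} {E F : Submodule R K} (h : E ≤ F) :
    vClosure R E ≤ vClosure R F := fun x hx => by
  rw [mem_vClosure] at hx ⊢
  exact fun y hy => hx y fun e he => hy e (h he)

theorem le_vClosure {R : Subring K} (E : Submodule R K) : E ≤ vClosure R E := fun x hx => by
  rw [mem_vClosure]
  exact fun y hy => mul_comm y x ▸ hy x hx

theorem vClosure_vClosure {R : Subring K} (E : Submodule R K) :
    vClosure R (vClosure R E) ≤ vClosure R E := fun x hx => by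
  rw [mem_vClosure] at hx ⊢
  exact fun y hy => hx y fun e he => mul_comm e y ▸ mem_vClosure.1 he y hy

theorem smul_vClosure_le {R : Subring K} (a : K) (E : Submodule R K) :
    a • vClosure R E ≤ vClosure R (a • E) := fun x hx => by
  obtain ⟨z, hz, rfl⟩ := (Submodule.mem_smul_pointwise_iff_exists _ _ _).1 hx
  rw [mem_vClosure] at hz ⊢
  intro y hy
  have := hz (y * a) fun e he => by
    have := hy (a * e) (Submodule.smul_mem_pointwise_smul e a E he)
    rwa [← mul_assoc] at this
  rw [smul_eq_mul]
  convert this using 1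
  ring

/-- The trivial operation `e`: `E^e = K` for all `E`. -/
def semistarE (R : Subring K) : SemistarOperation R :=
  .ofClosure (fun _ => ⊤) (fun _ _ _ _ => le_top) (fun _ _ _ _ => le_rfl) (fun _ _ => le_top)
    (fun _ _ => le_rfl)

/-- The identity operation: `E ↦ E`. -/
def semistarD (R : Subring K) : SemistarOperation R :=
  .ofClosure (fun E => E) (fun _ _ _ _ => le_rfl) (fun _ _ _ h => h) (fun _ _ => le_rfl)
    (fun _ _ => le_rfl)

/-- The operation `E ↦ E_v`. -/
def semistarV (R : Subring K) : SemistarOperation R :=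
  .ofClosure (vClosure R) (fun a _ E _ => smul_vClosure_le a E) (fun _ _ _ h => vClosure_mono h)
    (fun E _ => le_vClosure E) (fun E _ => vClosure_vClosure E)

/-- The operation `*_T : E ↦ ET` of an overring `T` of `R`; here `ET` is the `R`-submodule of `K`
generated by the products `x t` with `x ∈ E`, `t ∈ T`. -/
def semistarExtend (R T : Subring K) : SemistarOperation R :=
  .ofClosure (fun E => E * Submodule.span R (T : Set K))
    (fun a _ E _ => by
      rintro x hx
      obtain ⟨z, hz, rfl⟩ := (Submodule.mem_smul_pointwise_iff_exists _ _ _).1 hx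
      refine Submodule.mul_induction_on hz (fun m hm n hn => ?_) (fun p q hp hq => ?_)
      · rw [smul_eq_mul, ← mul_assoc]
        exact Submodule.mul_mem_mul (Submodule.smul_mem_pointwise_smul m a E hm) hn
      · rw [smul_add]
        exact add_mem hp hq)
    (fun _ _ _ h => mul_le_mul' h le_rfl)
    (fun E _ x hx => by
      have := Submodule.mul_mem_mul hx (Submodule.subset_span (R := R) (s := (T : Set K)) T.one_mem)
      rwa [mul_one] at this)
    (fun E _ => by
      rw [mul_assoc, Submodule.span_mul_span]
      refine mul_le_mul' le_rfl (Submodule.span_mono ?_)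
      rintro _ ⟨x, hx, y, hy, rfl⟩
      exact T.mul_mem hx hy)

/-- `E_t`: the union of the `F_v`, over the nonzero finitely generated `F ⊆ E`. -/
def tClosure (R : Subring K) (E : NonzeroSubmodule R) : Submodule R K where
  carrier := {x | ∃ F : NonzeroSubmodule R, (F.1.FG ∧ F ≤ E) ∧ x ∈ vClosure R F.1}
  zero_mem' := by
    obtain ⟨x, hx, hx0⟩ := (Submodule.ne_bot_iff E.1).1 E.2
    refine ⟨⟨Submodule.span R {x}, ?_⟩, ⟨?_, ?_⟩, zero_mem _⟩
    · simpa using hx0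
    · exact Submodule.fg_span_singleton x
    · exact (Submodule.span_singleton_le_iff_mem x E.1).2 hx
  add_mem' := by
    intro a b ha hb
    obtain ⟨F, ⟨hF, hFE⟩, ha⟩ := ha
    obtain ⟨G, ⟨hG, hGE⟩, hb⟩ := hb
    refine ⟨⟨F.1 ⊔ G.1, ne_bot_of_le F.2 le_sup_left⟩, ⟨hF.sup hG, ?_⟩,
      add_mem (vClosure_mono le_sup_left ha) (vClosure_mono le_sup_right hb)⟩
    exact sup_le (a := F.1) (b := G.1) (c := E.1) hFE hGE
  smul_mem' := by
    intro c x hx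
    obtain ⟨F, hF, hx⟩ := hx
    exact ⟨F, hF, Submodule.smul_mem _ c hx⟩

theorem mem_tClosure {R : Subring K} {E : NonzeroSubmodule R} {x : K} :
    x ∈ tClosure R E ↔ ∃ F : NonzeroSubmodule R, (F.1.FG ∧ F ≤ E) ∧ x ∈ vClosure R F.1 :=
  Iff.rfl

theorem le_tClosure {R : Subring K} (E : NonzeroSubmodule R) : E.1 ≤ tClosure R E := by
  intro x hx
  rw [mem_tClosure]
  obtain ⟨y, hy, hy0⟩ := (Submodule.ne_bot_iff E.1).1 E.2
  have hxs : Submodule.span R {x, y} ≤ E.1 := Submodule.span_le.2 (by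
    rintro z (rfl | rfl)
    · exact hx
    · exact hy)
  refine ⟨⟨Submodule.span R {x, y}, ?_⟩, ⟨?_, hxs⟩, le_vClosure _ (Submodule.subset_span (by simp))⟩
  · exact (Submodule.ne_bot_iff _).2 ⟨y, Submodule.subset_span (by simp), hy0⟩
  · exact Submodule.fg_span (by simp)

theorem tClosure_fg {R : Subring K} (E : NonzeroSubmodule R) (F : Submodule R K) (hF : F.FG)
    (h : F ≤ tClosure R E) :
    ∃ G : NonzeroSubmodule R, (G.1.FG ∧ G ≤ E) ∧ F ≤ vClosure R G.1 := by
  induction F, hF using Submodule.fg_induction with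
  | singleton x =>
    obtain ⟨G, hG, hx⟩ := mem_tClosure.1 (h (Submodule.mem_span_singleton_self x))
    exact ⟨G, hG, (Submodule.span_singleton_le_iff_mem _ _).2 hx⟩
  | sup M N _ _ hM hN =>
    obtain ⟨F, hF, hM⟩ := hM (le_sup_left.trans h)
    obtain ⟨G, hG, hN⟩ := hN (le_sup_right.trans h)
    exact ⟨⟨F.1 ⊔ G.1, ne_bot_of_le F.2 le_sup_left⟩,
      ⟨hF.1.sup hG.1, sup_le (a := F.1) (b := G.1) (c := E.1) hF.2 hG.2⟩,
      sup_le (hM.trans (vClosure_mono le_sup_left)) (hN.trans (vClosure_mono le_sup_right))⟩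

/-- The operation `E ↦ E_t`. -/
def semistarT (R : Subring K) : SemistarOperation R where
  toFun E := ⟨tClosure R E, ne_bot_of_le E.2 (le_tClosure E)⟩
  map_scale := by
    have key : ∀ (a : K) (ha : a ≠ 0) (E : NonzeroSubmodule R),
        a • tClosure R E ≤ tClosure R (E.scale a ha) := by
      intro a ha E x hx
      obtain ⟨z, hz, rfl⟩ := (Submodule.mem_smul_pointwise_iff_exists _ _ _).1 hx
      obtain ⟨F, ⟨hF, hFE⟩, hz⟩ := mem_tClosure.1 hz
      refine mem_tClosure.2 ⟨F.scale a ha, ⟨hF.map (DistribSMul.toLinearMap R K a), ?_⟩,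
        smul_vClosure_le a F.1 (Submodule.smul_mem_pointwise_smul z a _ hz)⟩
      exact Submodule.map_mono (f := DistribSMul.toLinearMap R K a) hFE
    intro a ha E
    apply Subtype.ext
    refine le_antisymm ?_ (key a ha E)
    change tClosure R (E.scale a ha) ≤ a • tClosure R E
    have h := key a⁻¹ (inv_ne_zero ha) (E.scale a ha)
    have h1 : (E.scale a ha).scale a⁻¹ (inv_ne_zero ha) = E := by
      apply Subtype.ext
      change a⁻¹ • a • E.1 = E.1
      rw [smul_smul, inv_mul_cancel₀ ha, one_smul]
    rw [h1] at h
    have h2 := Submodule.map_mono (f := DistribSMul.toLinearMap R K a) h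
    change a • (a⁻¹ • tClosure R (E.scale a ha)) ≤ a • tClosure R E at h2
    rwa [smul_smul, mul_inv_cancel₀ ha, one_smul] at h2
  monotone E F h := by
    intro x hx
    obtain ⟨G, hG, hx⟩ := mem_tClosure.1 hx
    exact mem_tClosure.2 ⟨G, ⟨hG.1, hG.2.trans h⟩, hx⟩
  le_closure E := le_tClosure E
  idempotent E := by
    apply Subtype.ext
    refine le_antisymm ?_ (le_tClosure _)
    intro x hx
    obtain ⟨F, ⟨hF, hFE⟩, hx⟩ := mem_tClosure.1 hx
    obtain ⟨G, hG, hFG⟩ := tClosure_fg E F.1 hF hFE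
    exact mem_tClosure.2 ⟨G, hG, vClosure_vClosure _ (vClosure_mono hFG hx)⟩

/-- The operation `E ↦ E^{s} ∩ E^{s'}`. -/
def SemistarOperation.meet {R : Subring K} (s s' : SemistarOperation R) : SemistarOperation R where
  toFun E := ⟨(s.toFun E).1 ⊓ (s'.toFun E).1,
    ne_bot_of_le E.2 (le_inf (s.le_closure E) (s'.le_closure E))⟩
  map_scale a ha E := by
    apply Subtype.ext
    change (s.toFun (E.scale a ha)).1 ⊓ (s'.toFun (E.scale a ha)).1 =
      a • ((s.toFun E).1 ⊓ (s'.toFun E).1)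
    rw [s.map_scale, s'.map_scale]
    exact (Submodule.map_inf (DistribSMul.toLinearMap R K a) (mul_right_injective₀ ha)).symm
  monotone E F h := fun _ hx => ⟨s.monotone E F h hx.1, s'.monotone E F h hx.2⟩
  le_closure E := fun _ hx => ⟨s.le_closure E hx, s'.le_closure E hx⟩
  idempotent E := by
    apply Subtype.ext
    refine le_antisymm (le_inf ?_ ?_) ?_
    · refine inf_le_left.trans (le_of_le_of_eq (b := (s.toFun (s.toFun E)).1) ?_ ?_)
      · exact s.monotone _ _ (inf_le_left (a := (s.toFun E).1))
      · rw [s.idempotent]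
    · refine inf_le_right.trans (le_of_le_of_eq (b := (s'.toFun (s'.toFun E)).1) ?_ ?_)
      · exact s'.monotone _ _ (inf_le_right (b := (s'.toFun E).1))
      · rw [s'.idempotent]
    · exact fun _ hx => ⟨s.le_closure _ hx, s'.le_closure _ hx⟩

end Semistar

/-- The ring `k[[X^g : g ∈ G]]` inside `k((X))`: the power series in which only exponents from the
additive submonoid of `ℕ` generated by `G` occur. -/
noncomputable def powerSeriesIn (k : Type u) [Field k] (G : Set ℕ) : Subring k⸨X⸩ :=
  Subring.map (HahnSeries.ofPowerSeries ℤ k)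
    { carrier := {f : PowerSeries k |
        ∀ n : ℕ, PowerSeries.coeff n f ≠ 0 → n ∈ AddSubmonoid.closure G}
      zero_mem' := fun n hn => absurd (by simp) hn
      one_mem' := fun n hn => by
        rw [PowerSeries.coeff_one] at hn
        have : n = 0 := by
          by_contra h
          exact hn (if_neg h)
        exact this ▸ zero_mem _
      add_mem' := fun {f g} hf hg n hn => by
        by_cases h : PowerSeries.coeff n f = 0
        · refine hg n fun h' => hn ?_
          rw [map_add, h, h', add_zero]
        · exact hf n h
      neg_mem' := fun {f} hf n hn => hf n fun h => hn (by rw [map_neg, h, neg_zero])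
      mul_mem' := fun {f g} hf hg n hn => by
        rw [PowerSeries.coeff_mul] at hn
        obtain ⟨p, hp, hne⟩ := Finset.exists_ne_zero_of_sum_ne_zero hn
        rw [← Finset.HasAntidiagonal.mem_antidiagonal.1 hp]
        exact add_mem (hf _ (left_ne_zero_of_mul hne)) (hg _ (right_ne_zero_of_mul hne)) }

/-!
Write `V = k[[X]]`, with `L = k((X))`. The ring `R = k[[X³, X⁴, X⁵]]` consists of the power series
without terms in `X` and `X²`, so it contains the conductor `X³ V`.

Everything rests on a classification of the nonzero `R`-submodules `E` of `L`
(`submodule_classification`). If the orders of the elements of `E` are unbounded below, then `E = L`.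
Otherwise, dividing by an element of least order, one may assume `1 ∈ E ⊆ V`; then `E` contains `X³ V`
and is determined by a subspace of `V / X³ V` containing `1`. Such a module is `R`, or is cut out of
`V` by one (possibly trivial) linear condition `a f₁ + b f₂ = 0` on the coefficients
(`eq_one_or_eq_jetModule`), and a unit `1 - c X` moves every condition with `b ≠ 0` to `f₂ = 0`. Up to
scaling, therefore, `E` is one of `R`, `R₁ = R + R X²`, `N = R + R X`, `V`, `L`. All but `L` are
finitely generated, whence `R` is Noetherian and every semistar operation has finite character. An
overring is a module of this kind closed under squaring, which leaves only `R`, `R₁`, `V`, `L`.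

Let `*` be a semistar operation. The closure of an overring is an overring, and `V* = L` forces
`R* = L` because `X³ V ⊆ R`. So `*` is determined by `R*`, `R₁*` and `N*` (`profile_injective`).
If `R*` is not `R`, then it determines the other two. If `R* = R`, then `R₁*` is `R₁` or `V` and `N*`
is `N` or `V`; since `X R₁ ⊆ N`, the equality `R₁* = V` implies `X² ∈ N*` and `N* = V`. This leaves six
triples (`profile_cases`), and the six given operations realize them. For the divisorial closure
this uses that `R₁` has dual `X³ V`, so that its divisorial closure is `V`; this also shows that `R`
is not divisorial.
-/

/-! ### Low-order coefficients of Laurent series -/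

section LaurentJets

variable {k : Type u} [Field k]

/-- The ring `k[[X³, X⁴, X⁵]]`. -/
noncomputable abbrev spaceCuspRing (k : Type u) [Field k] : Subring k⸨X⸩ := powerSeriesIn k {3, 4, 5}

/-- The ring `k[[X², X³]]`. -/
noncomputable abbrev cuspRing (k : Type u) [Field k] : Subring k⸨X⸩ := powerSeriesIn k {2, 3}

/-- The ring `k[[X]]`. -/
noncomputable abbrev valRing (k : Type u) [Field k] : Subring k⸨X⸩ :=
  (HahnSeries.ofPowerSeries ℤ k).range

/-- The monomial `Xⁿ`, for `n : ℤ`. -/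
noncomputable abbrev mono (k : Type u) [Field k] (n : ℤ) : k⸨X⸩ := HahnSeries.single n 1

theorem coeff_ofPowerSeries_zero (p : PowerSeries k) :
    (HahnSeries.ofPowerSeries ℤ k p).coeff 0 = PowerSeries.coeff 0 p :=
  HahnSeries.ofPowerSeries_apply_coeff p 0

theorem coeff_ofPowerSeries_one (p : PowerSeries k) :
    (HahnSeries.ofPowerSeries ℤ k p).coeff 1 = PowerSeries.coeff 1 p :=
  HahnSeries.ofPowerSeries_apply_coeff p 1

theorem coeff_ofPowerSeries_two (p : PowerSeries k) :
    (HahnSeries.ofPowerSeries ℤ k p).coeff 2 = PowerSeries.coeff 2 p :=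
  HahnSeries.ofPowerSeries_apply_coeff p 2

theorem coeff_C_mul (c : k) (f : k⸨X⸩) (n : ℤ) :
    (HahnSeries.C c * f).coeff n = c * f.coeff n := by
  rw [HahnSeries.C_apply, HahnSeries.coeff_single_mul, sub_zero]

theorem mem_valRing_of_coeff {f : k⸨X⸩} (h : ∀ n < 0, f.coeff n = 0) : f ∈ valRing k := by
  refine ⟨PowerSeries.mk fun n => f.coeff n, ?_⟩
  ext n
  obtain hn | hn := lt_or_ge n 0
  · rw [h n hn, PowerSeries.coeff_coe, if_pos hn]
  · lift n to ℕ using hn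
    rw [HahnSeries.ofPowerSeries_apply_coeff, PowerSeries.coeff_mk]

theorem coeff_eq_zero_of_mem_valRing {f : k⸨X⸩} (h : f ∈ valRing k) {n : ℤ} (hn : n < 0) :
    f.coeff n = 0 := by
  obtain ⟨p, rfl⟩ := h
  rw [PowerSeries.coeff_coe, if_pos hn]

theorem mem_valRing_of_order {f : k⸨X⸩} (h : 0 ≤ f.order) : f ∈ valRing k :=
  mem_valRing_of_coeff fun _ hn => HahnSeries.coeff_eq_zero_of_lt_order (hn.trans_le h)

theorem order_nonneg_of_mem_valRing {f : k⸨X⸩} (h : f ∈ valRing k) : 0 ≤ f.order := by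
  by_contra! hn
  have := coeff_eq_zero_of_mem_valRing h hn
  rw [HahnSeries.coeff_order_eq_zero] at this
  simp [this] at hn

theorem mem_spaceCuspRing {f : k⸨X⸩} :
    f ∈ spaceCuspRing k ↔ f ∈ valRing k ∧ f.coeff 1 = 0 ∧ f.coeff 2 = 0 := by
  have key : ∀ n : ℕ, n ∈ AddSubmonoid.closure ({3, 4, 5} : Set ℕ) ↔ n ≠ 1 ∧ n ≠ 2 := by
    intro n
    constructor
    · intro h
      have : n = 0 ∨ 3 ≤ n := by
        induction h using AddSubmonoid.closure_induction with
        | mem x hx =>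
          simp only [Set.mem_insert_iff, Set.mem_singleton_iff] at hx
          omega
        | zero => exact Or.inl rfl
        | add x y _ _ hx hy => omega
      omega
    · induction n using Nat.strong_induction_on with
      | _ n ih =>
        intro h
        by_cases h0 : n = 0
        · exact h0 ▸ zero_mem _
        by_cases h6 : n < 6
        · refine AddSubmonoid.subset_closure ?_
          simp only [Set.mem_insert_iff, Set.mem_singleton_iff]
          omega
        · have := add_mem (ih (n - 3) (by omega) (by omega))
            (AddSubmonoid.subset_closure (show 3 ∈ ({3, 4, 5} : Set ℕ) by simp))
          rwa [Nat.sub_add_cancel (by omega)] at this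
  constructor
  · rintro ⟨p, hp, rfl⟩
    refine ⟨⟨p, rfl⟩, ?_, ?_⟩
    · rw [coeff_ofPowerSeries_one]
      by_contra h
      exact ((key 1).1 (hp 1 h)).1 rfl
    · rw [coeff_ofPowerSeries_two]
      by_contra h
      exact ((key 2).1 (hp 2 h)).2 rfl
  · rintro ⟨⟨p, rfl⟩, h1, h2⟩
    rw [coeff_ofPowerSeries_one] at h1
    rw [coeff_ofPowerSeries_two] at h2
    exact ⟨p, fun n hn => (key n).2
      ⟨fun h => hn (h ▸ h1), fun h => hn (h ▸ h2)⟩, rfl⟩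

theorem mem_cuspRing {f : k⸨X⸩} : f ∈ cuspRing k ↔ f ∈ valRing k ∧ f.coeff 1 = 0 := by
  have key : ∀ n : ℕ, n ∈ AddSubmonoid.closure ({2, 3} : Set ℕ) ↔ n ≠ 1 := by
    intro n
    constructor
    · intro h
      have : n = 0 ∨ 2 ≤ n := by
        induction h using AddSubmonoid.closure_induction with
        | mem x hx =>
          simp only [Set.mem_insert_iff, Set.mem_singleton_iff] at hx
          omega
        | zero => exact Or.inl rfl
        | add x y _ _ hx hy => omega
      omega
    · induction n using Nat.strong_induction_on with
      | _ n ih =>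
        intro h
        by_cases h0 : n = 0
        · exact h0 ▸ zero_mem _
        by_cases h6 : n < 4
        · refine AddSubmonoid.subset_closure ?_
          simp only [Set.mem_insert_iff, Set.mem_singleton_iff]
          omega
        · have := add_mem (ih (n - 2) (by omega) (by omega))
            (AddSubmonoid.subset_closure (show 2 ∈ ({2, 3} : Set ℕ) by simp))
          rwa [Nat.sub_add_cancel (by omega)] at this
  constructor
  · rintro ⟨p, hp, rfl⟩
    refine ⟨⟨p, rfl⟩, ?_⟩
    rw [coeff_ofPowerSeries_one]
    by_contra h
    exact (key 1).1 (hp 1 h) rfl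
  · rintro ⟨⟨p, rfl⟩, h1⟩
    rw [coeff_ofPowerSeries_one] at h1
    exact ⟨p, fun n hn => (key n).2 fun h => hn (h ▸ h1), rfl⟩

theorem mem_spaceCuspRing_of_order {f : k⸨X⸩} (h : f = 0 ∨ 3 ≤ f.order) : f ∈ spaceCuspRing k := by
  obtain rfl | h := h
  · exact zero_mem _
  · exact mem_spaceCuspRing.2 ⟨mem_valRing_of_order (by omega),
      HahnSeries.coeff_eq_zero_of_lt_order (by omega),
      HahnSeries.coeff_eq_zero_of_lt_order (by omega)⟩

theorem order_ge_three {f : k⸨X⸩} (hV : f ∈ valRing k) (h0 : f.coeff 0 = 0) (h1 : f.coeff 1 = 0)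
    (h2 : f.coeff 2 = 0) : f = 0 ∨ 3 ≤ f.order := by
  by_contra! h
  have hn := order_nonneg_of_mem_valRing hV
  have hc := fun e => h.1 (HahnSeries.coeff_order_eq_zero.1 e)
  obtain e | e | e : f.order = 0 ∨ f.order = 1 ∨ f.order = 2 := by omega
  · exact hc (e ▸ h0)
  · exact hc (e ▸ h1)
  · exact hc (e ▸ h2)

theorem coeff_mul_zero {f g : k⸨X⸩} (hf : f ∈ valRing k) (hg : g ∈ valRing k) :
    (f * g).coeff 0 = f.coeff 0 * g.coeff 0 := by
  obtain ⟨p, rfl⟩ := hf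
  obtain ⟨q, rfl⟩ := hg
  rw [← map_mul]
  simp only [coeff_ofPowerSeries_zero]
  simp

theorem coeff_mul_one {f g : k⸨X⸩} (hf : f ∈ valRing k) (hg : g ∈ valRing k) :
    (f * g).coeff 1 = f.coeff 0 * g.coeff 1 + f.coeff 1 * g.coeff 0 := by
  obtain ⟨p, rfl⟩ := hf
  obtain ⟨q, rfl⟩ := hg
  rw [← map_mul]
  simp only [coeff_ofPowerSeries_zero, coeff_ofPowerSeries_one, PowerSeries.coeff_mul]
  rw [Finset.Nat.sum_antidiagonal_eq_sum_range_succ_mk]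
  simp [Finset.sum_range_succ]

theorem coeff_mul_two {f g : k⸨X⸩} (hf : f ∈ valRing k) (hg : g ∈ valRing k) :
    (f * g).coeff 2 = f.coeff 0 * g.coeff 2 + f.coeff 1 * g.coeff 1 + f.coeff 2 * g.coeff 0 := by
  obtain ⟨p, rfl⟩ := hf
  obtain ⟨q, rfl⟩ := hg
  rw [← map_mul]
  simp only [coeff_ofPowerSeries_zero, coeff_ofPowerSeries_one, coeff_ofPowerSeries_two,
    PowerSeries.coeff_mul]
  rw [Finset.Nat.sum_antidiagonal_eq_sum_range_succ_mk]
  simp [Finset.sum_range_succ]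

theorem order_inv {x : k⸨X⸩} (hx : x ≠ 0) : x⁻¹.order = -x.order := by
  have := HahnSeries.order_mul hx (inv_ne_zero hx)
  rw [mul_inv_cancel₀ hx, HahnSeries.order_one] at this
  omega

theorem inv_mem_valRing {u : k⸨X⸩} (hu : u ∈ valRing k) (h0 : u.coeff 0 ≠ 0) :
    u⁻¹ ∈ valRing k := by
  have hu0 : u ≠ 0 := by
    rintro rfl
    simp at h0
  have := HahnSeries.order_le_of_coeff_ne_zero h0
  exact mem_valRing_of_order (by rw [order_inv hu0]; omega)

theorem mono_ne_zero (n : ℤ) : mono k n ≠ 0 := by simp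

theorem order_mono (n : ℤ) : (mono k n).order = n := HahnSeries.order_single one_ne_zero

theorem coeff_mono_mul (n : ℤ) (f : k⸨X⸩) (m : ℤ) : (mono k n * f).coeff m = f.coeff (m - n) := by
  rw [HahnSeries.coeff_single_mul, one_mul]

theorem mono_mem_valRing {n : ℤ} (hn : 0 ≤ n) : mono k n ∈ valRing k :=
  mem_valRing_of_order (by rw [order_mono]; exact hn)

theorem C_mem_spaceCuspRing (c : k) : HahnSeries.C c ∈ spaceCuspRing k :=
  mem_spaceCuspRing.2 ⟨⟨PowerSeries.C c, by simp⟩, by simp [HahnSeries.C_apply],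
    by simp [HahnSeries.C_apply]⟩

theorem spaceCuspRing_le_cuspRing : spaceCuspRing k ≤ cuspRing k := fun _ hf =>
  mem_cuspRing.2 ⟨(mem_spaceCuspRing.1 hf).1, (mem_spaceCuspRing.1 hf).2.1⟩

theorem cuspRing_le_valRing : cuspRing k ≤ valRing k := fun _ hf => (mem_cuspRing.1 hf).1

theorem spaceCuspRing_le_valRing : spaceCuspRing k ≤ valRing k :=
  spaceCuspRing_le_cuspRing.trans cuspRing_le_valRing

end LaurentJets

/-! ### Submodules of the Laurent series field -/

section SubmoduleClassification

variable {k : Type u} [Field k]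

/-- The `k[[X³, X⁴, X⁵]]`-module of the power series `f₀ + f₁ X + f₂ X² + ⋯` with
`a f₁ + b f₂ = 0`. -/
noncomputable def jetModule (a b : k) : Submodule (spaceCuspRing k) k⸨X⸩ where
  carrier := {f | f ∈ valRing k ∧ a * f.coeff 1 + b * f.coeff 2 = 0}
  zero_mem' := ⟨zero_mem _, by simp⟩
  add_mem' := fun {f g} hf hg => ⟨add_mem hf.1 hg.1, by
    rw [HahnSeries.coeff_add, HahnSeries.coeff_add]
    linear_combination hf.2 + hg.2⟩
  smul_mem' := fun ⟨c, hc⟩ f hf => by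
    obtain ⟨hcV, hc1, hc2⟩ := mem_spaceCuspRing.1 hc
    rw [Subring.smul_def, smul_eq_mul]
    refine ⟨mul_mem hcV hf.1, ?_⟩
    rw [coeff_mul_one hcV hf.1, coeff_mul_two hcV hf.1, hc1, hc2]
    linear_combination c.coeff 0 * hf.2

theorem mem_jetModule {a b : k} {f : k⸨X⸩} :
    f ∈ jetModule a b ↔ f ∈ valRing k ∧ a * f.coeff 1 + b * f.coeff 2 = 0 := Iff.rfl

theorem mem_one_iff {f : k⸨X⸩} :
    f ∈ (1 : Submodule (spaceCuspRing k) k⸨X⸩) ↔ f ∈ spaceCuspRing k := by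
  rw [Submodule.mem_one]
  exact ⟨fun ⟨y, hy⟩ => hy ▸ y.2, fun h => ⟨⟨f, h⟩, rfl⟩⟩

theorem mem_jetModule_one_zero {f : k⸨X⸩} :
    f ∈ jetModule (1 : k) 0 ↔ f ∈ cuspRing k := by
  rw [mem_jetModule, mem_cuspRing]
  simp

theorem mem_jetModule_zero_zero {f : k⸨X⸩} :
    f ∈ jetModule (0 : k) 0 ↔ f ∈ valRing k := by
  rw [mem_jetModule]
  simp

theorem mem_jetModule_zero_one {f : k⸨X⸩} :
    f ∈ jetModule (0 : k) 1 ↔ f ∈ valRing k ∧ f.coeff 2 = 0 := by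
  rw [mem_jetModule]
  simp

theorem mul_mem_of_mem {E : Submodule (spaceCuspRing k) k⸨X⸩} {c f : k⸨X⸩}
    (hc : c ∈ spaceCuspRing k) (hf : f ∈ E) : c * f ∈ E :=
  E.smul_mem ⟨c, hc⟩ hf

/-- A module containing `1` contains every series of order at least three, so membership of a power
series is decided by its coefficients at `X` and `X²`. -/
theorem mem_of_coeff_eq {E : Submodule (spaceCuspRing k) k⸨X⸩} (h1 : (1 : k⸨X⸩) ∈ E) {f g : k⸨X⸩}
    (hf : f ∈ valRing k) (hgV : g ∈ valRing k) (hg : g ∈ E) (e1 : f.coeff 1 = g.coeff 1)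
    (e2 : f.coeff 2 = g.coeff 2) : f ∈ E := by
  have : f - g ∈ spaceCuspRing k :=
    mem_spaceCuspRing.2 ⟨sub_mem hf hgV, by simp [e1], by simp [e2]⟩
  have := add_mem (mul_mem_of_mem this h1) hg
  simpa using this

theorem eq_one_or_eq_jetModule {E : Submodule (spaceCuspRing k) k⸨X⸩} (h1 : (1 : k⸨X⸩) ∈ E)
    (hE : ∀ f ∈ E, f ∈ valRing k) : E = 1 ∨ ∃ a b, E = jetModule a b := by
  by_cases h : ∀ f ∈ E, f.coeff 1 = 0 ∧ f.coeff 2 = 0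
  · left
    ext f
    rw [mem_one_iff]
    refine ⟨fun hf => mem_spaceCuspRing.2 ⟨hE f hf, h f hf⟩, fun hf => ?_⟩
    simpa using mul_mem_of_mem hf h1
  right
  push Not at h
  obtain ⟨f, hf, hf12⟩ := h
  have hC : ∀ (c : k) (g : k⸨X⸩), g ∈ E → HahnSeries.C c * g ∈ E :=
    fun c g => mul_mem_of_mem (C_mem_spaceCuspRing c)
  by_cases h' : ∀ g ∈ E, f.coeff 2 * g.coeff 1 + -f.coeff 1 * g.coeff 2 = 0
  · refine ⟨f.coeff 2, -f.coeff 1, le_antisymm (fun g hg => ⟨hE g hg, h' g hg⟩) ?_⟩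
    rintro g ⟨hgV, hg⟩
    by_cases hz : f.coeff 1 = 0
    · have hf2 := hf12 hz
      have hg' := hC (g.coeff 2 / f.coeff 2) f hf
      refine mem_of_coeff_eq h1 hgV (hE _ hg') hg' ?_ ?_
      · rw [hz] at hg
        simp only [coeff_C_mul]
        have : g.coeff 1 = 0 := by simpa [hf2] using hg
        rw [this, hz, mul_zero]
      · simp only [coeff_C_mul]
        field_simp
    · have hg' := hC (g.coeff 1 / f.coeff 1) f hf
      refine mem_of_coeff_eq h1 hgV (hE _ hg') hg' ?_ ?_
      · simp only [coeff_C_mul]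
        field_simp
      · simp only [coeff_C_mul]
        field_simp
        linear_combination -hg
  · push Not at h'
    obtain ⟨g, hg, hd⟩ := h'
    refine ⟨0, 0, le_antisymm (fun g hg => ⟨hE g hg, by simp⟩) ?_⟩
    rintro y ⟨hy, -⟩
    set d := f.coeff 2 * g.coeff 1 + -f.coeff 1 * g.coeff 2 with hdef
    -- Cramer's rule for the pair of coefficients at `X` and `X²`.
    have hz := add_mem
      (hC ((y.coeff 2 * g.coeff 1 - y.coeff 1 * g.coeff 2) / d) f hf)
      (hC ((f.coeff 2 * y.coeff 1 - f.coeff 1 * y.coeff 2) / d) g hg)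
    refine mem_of_coeff_eq h1 hy (hE _ hz) hz ?_ ?_
    · simp only [HahnSeries.coeff_add, coeff_C_mul]
      field_simp
      rw [hdef]
      ring
    · simp only [HahnSeries.coeff_add, coeff_C_mul]
      field_simp
      rw [hdef]
      ring

theorem mem_smul_iff {E : Submodule (spaceCuspRing k) k⸨X⸩} {a : k⸨X⸩} (ha : a ≠ 0) {x : k⸨X⸩} :
    x ∈ a • E ↔ a⁻¹ * x ∈ E := by
  rw [Submodule.mem_smul_pointwise_iff_exists]
  constructor
  · rintro ⟨y, hy, rfl⟩
    rwa [smul_eq_mul, inv_mul_cancel_left₀ ha]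
  · exact fun h => ⟨_, h, by rw [smul_eq_mul, mul_inv_cancel_left₀ ha]⟩

/-- Elements of arbitrarily negative order generate the whole field. -/
theorem eq_top_of_order_unbounded {E : Submodule (spaceCuspRing k) k⸨X⸩}
    (h : ∀ n : ℤ, ∃ x ∈ E, x ≠ 0 ∧ x.order ≤ n) : E = ⊤ := by
  rw [eq_top_iff]
  intro z _
  by_cases hz : z = 0
  · exact hz ▸ zero_mem _
  obtain ⟨x, hx, hx0, hxn⟩ := h (z.order - 3)
  have : z * x⁻¹ ∈ spaceCuspRing k := mem_spaceCuspRing_of_order <| Or.inr <| by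
    rw [HahnSeries.order_mul hz (inv_ne_zero hx0), order_inv hx0]
    omega
  have := mul_mem_of_mem this hx
  rwa [inv_mul_cancel_right₀ hx0] at this

/-- Dividing by an element of least order, if there is one, leads to a module of power series that
contains `1`. -/
theorem exists_normalized {E : Submodule (spaceCuspRing k) k⸨X⸩} (hE : E ≠ ⊥) :
    E = ⊤ ∨ ∃ a : k⸨X⸩, a ≠ 0 ∧ ∃ F : Submodule (spaceCuspRing k) k⸨X⸩,
      E = a • F ∧ 1 ∈ F ∧ ∀ f ∈ F, f ∈ valRing k := by
  by_cases h : ∀ n : ℤ, ∃ x ∈ E, x ≠ 0 ∧ x.order ≤ n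
  · exact Or.inl (eq_top_of_order_unbounded h)
  right
  push Not at h
  obtain ⟨b, hb⟩ := h
  obtain ⟨x₀, hx₀, hx₀0⟩ := (Submodule.ne_bot_iff E).1 hE
  obtain ⟨m, ⟨a, haE, ha, hm⟩, hmin⟩ := Int.exists_least_of_bdd
    (P := fun n => ∃ x ∈ E, x ≠ 0 ∧ x.order = n)
    ⟨b, by rintro _ ⟨x, hx, hx0, rfl⟩; exact (hb x hx hx0).le⟩ ⟨_, x₀, hx₀, hx₀0, rfl⟩
  refine ⟨a, ha, a⁻¹ • E, ?_, ?_, ?_⟩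
  · rw [smul_smul, mul_inv_cancel₀ ha, one_smul]
  · rw [mem_smul_iff (inv_ne_zero ha), inv_inv, mul_one]
    exact haE
  · intro f hf
    rw [mem_smul_iff (inv_ne_zero ha), inv_inv] at hf
    by_cases hf0 : f = 0
    · exact hf0 ▸ zero_mem _
    have := hmin _ ⟨_, hf, mul_ne_zero ha hf0, rfl⟩
    rw [HahnSeries.order_mul ha hf0] at this
    exact mem_valRing_of_order (by omega)

/-- Multiplication by the unit `1 - c X` turns the condition `f₂ = c f₁` into `f₂ = 0`. -/
theorem jetModule_eq_smul (c : k) : ∃ a : k⸨X⸩, a ≠ 0 ∧ jetModule c (-1) = a • jetModule 0 1 := by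
  set u : k⸨X⸩ := 1 - HahnSeries.C c * mono k 1 with hu
  have huV : u ∈ valRing k := sub_mem (one_mem _)
    (mul_mem (spaceCuspRing_le_valRing (C_mem_spaceCuspRing c)) (mono_mem_valRing zero_le_one))
  have h0 : u.coeff 0 = 1 := by simp [hu, HahnSeries.C_apply]
  have h1 : u.coeff 1 = -c := by simp [hu, HahnSeries.C_apply]
  have h2 : u.coeff 2 = 0 := by simp [hu, HahnSeries.C_apply]
  have hne : u ≠ 0 := by
    intro h
    simp [h] at h0
  have hinv := inv_mem_valRing huV (by simp [h0])
  refine ⟨u⁻¹, inv_ne_zero hne, ?_⟩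
  ext f
  rw [mem_smul_iff (inv_ne_zero hne), inv_inv, mem_jetModule_zero_one, mem_jetModule]
  constructor
  · rintro ⟨hf, h⟩
    refine ⟨mul_mem huV hf, ?_⟩
    rw [coeff_mul_two huV hf, h0, h1, h2]
    linear_combination -h
  · rintro ⟨hf, h⟩
    have hf' : f ∈ valRing k := by
      have := mul_mem hinv hf
      rwa [inv_mul_cancel_left₀ hne] at this
    refine ⟨hf', ?_⟩
    rw [coeff_mul_two huV hf', h0, h1, h2] at h
    linear_combination -h

theorem jetModule_mul {r : k} (hr : r ≠ 0) (a b : k) :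
    jetModule (r * a) (r * b) = jetModule a b := by
  ext f
  rw [mem_jetModule, mem_jetModule]
  have : r * a * f.coeff 1 + r * b * f.coeff 2 = r * (a * f.coeff 1 + b * f.coeff 2) := by ring
  rw [this]
  simp [hr]

/-- Up to scaling, a nonzero `k[[X³, X⁴, X⁵]]`-submodule of `k((X))` is the whole field or one of the
four modules generated over `k[[X³, X⁴, X⁵]]` by `1`, by `1, X²`, by `1, X` and by `1, X, X²`. -/
theorem submodule_classification {E : Submodule (spaceCuspRing k) k⸨X⸩} (hE : E ≠ ⊥) :
    E = ⊤ ∨ ∃ a : k⸨X⸩, a ≠ 0 ∧ ∃ F, E = a • F ∧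
      (F = 1 ∨ F = jetModule 1 0 ∨ F = jetModule 0 1 ∨ F = jetModule 0 0) := by
  obtain h | ⟨a, ha, F, rfl, h1, hF⟩ := exists_normalized hE
  · exact Or.inl h
  right
  obtain rfl | ⟨c, d, rfl⟩ := eq_one_or_eq_jetModule h1 hF
  · exact ⟨a, ha, _, rfl, Or.inl rfl⟩
  by_cases hd : d = 0
  · subst hd
    by_cases hc : c = 0
    · subst hc
      exact ⟨a, ha, _, rfl, by simp⟩
    · refine ⟨a, ha, _, rfl, ?_⟩
      have := jetModule_mul hc 1 0
      rw [mul_one, mul_zero] at this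
      simp [this]
  · have h2 := jetModule_mul (neg_ne_zero.2 hd) (-c / d) (-1)
    rw [show -d * (-c / d) = c by field_simp, neg_mul_neg, mul_one] at h2
    obtain ⟨u, hu, h3⟩ := jetModule_eq_smul (-c / d)
    refine ⟨a * u, mul_ne_zero ha hu, jetModule 0 1, ?_, by simp⟩
    rw [h2, h3, smul_smul]

theorem one_mem_jetModule (a b : k) : (1 : k⸨X⸩) ∈ jetModule a b :=
  mem_jetModule.2 ⟨one_mem _, by simp [HahnSeries.coeff_one]⟩

theorem mono_one_mem_jetModule (b : k) : mono k 1 ∈ jetModule 0 b :=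
  mem_jetModule.2 ⟨mono_mem_valRing zero_le_one, by simp⟩

theorem mono_two_mem_jetModule (a : k) : mono k 2 ∈ jetModule a 0 :=
  mem_jetModule.2 ⟨mono_mem_valRing zero_le_two, by simp⟩

theorem one_fg : (1 : Submodule (spaceCuspRing k) k⸨X⸩).FG := by
  rw [Submodule.one_eq_span]
  exact Submodule.fg_span_singleton _

theorem mem_of_generators {E : Submodule (spaceCuspRing k) k⸨X⸩} {f : k⸨X⸩} (hf : f ∈ valRing k)
    (h0 : (1 : k⸨X⸩) ∈ E) (h1 : f.coeff 1 = 0 ∨ mono k 1 ∈ E)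
    (h2 : f.coeff 2 = 0 ∨ mono k 2 ∈ E) : f ∈ E := by
  have hC : ∀ c : k, HahnSeries.C c ∈ valRing k := fun c =>
    spaceCuspRing_le_valRing (C_mem_spaceCuspRing c)
  refine mem_of_coeff_eq h0 hf
    (g := HahnSeries.C (f.coeff 1) * mono k 1 + HahnSeries.C (f.coeff 2) * mono k 2)
    (add_mem (mul_mem (hC _) (mono_mem_valRing zero_le_one))
      (mul_mem (hC _) (mono_mem_valRing zero_le_two))) (add_mem ?_ ?_) ?_ ?_
  · obtain h | h := h1
    · simp [h]
    · exact mul_mem_of_mem (C_mem_spaceCuspRing _) h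
  · obtain h | h := h2
    · simp [h]
    · exact mul_mem_of_mem (C_mem_spaceCuspRing _) h
  · simp only [HahnSeries.coeff_add, coeff_C_mul]
    simp
  · simp only [HahnSeries.coeff_add, coeff_C_mul]
    simp

theorem jetModule_one_zero_fg : (jetModule (1 : k) 0).FG := by
  have : jetModule (1 : k) 0 = Submodule.span _ {1, mono k 2} := by
    apply le_antisymm
    · intro f hf
      refine mem_of_generators hf.1 (Submodule.subset_span (by simp)) (Or.inl ?_)
        (Or.inr (Submodule.subset_span (by simp)))
      simpa using hf.2
    · rw [Submodule.span_le]
      rintro _ (rfl | rfl)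
      · exact one_mem_jetModule _ _
      · exact mono_two_mem_jetModule _
  rw [this]
  exact Submodule.fg_span (by simp)

theorem jetModule_zero_one_fg : (jetModule (0 : k) 1).FG := by
  have : jetModule (0 : k) 1 = Submodule.span _ {1, mono k 1} := by
    apply le_antisymm
    · intro f hf
      refine mem_of_generators hf.1 (Submodule.subset_span (by simp))
        (Or.inr (Submodule.subset_span (by simp))) (Or.inl ?_)
      simpa using hf.2
    · rw [Submodule.span_le]
      rintro _ (rfl | rfl)
      · exact one_mem_jetModule _ _
      · exact mono_one_mem_jetModule _
  rw [this]
  exact Submodule.fg_span (by simp)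

theorem jetModule_zero_zero_fg : (jetModule (0 : k) 0).FG := by
  have : jetModule (0 : k) 0 = Submodule.span _ {1, mono k 1, mono k 2} := by
    apply le_antisymm
    · intro f hf
      exact mem_of_generators hf.1 (Submodule.subset_span (by simp))
        (Or.inr (Submodule.subset_span (by simp))) (Or.inr (Submodule.subset_span (by simp)))
    · rw [Submodule.span_le]
      rintro _ (rfl | rfl | rfl)
      · exact one_mem_jetModule _ _
      · exact mono_one_mem_jetModule _
      · exact mono_two_mem_jetModule _
  rw [this]
  exact Submodule.fg_span (by simp)

theorem fg_or_eq_top (E : Submodule (spaceCuspRing k) k⸨X⸩) : E.FG ∨ E = ⊤ := by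
  by_cases hE : E = ⊥
  · exact Or.inl (hE ▸ Submodule.fg_bot)
  obtain h | ⟨a, ha, F, rfl, hF⟩ := submodule_classification hE
  · exact Or.inr h
  refine Or.inl (Submodule.FG.map (DistribSMul.toLinearMap (spaceCuspRing k) k⸨X⸩ a) ?_)
  obtain rfl | rfl | rfl | rfl := hF
  exacts [one_fg, jetModule_one_zero_fg, jetModule_zero_one_fg, jetModule_zero_zero_fg]

end SubmoduleClassification

/-! ### Ring structure and overrings of `k[[X³, X⁴, X⁵]]` -/

section RingStructure

variable (k : Type u) [Field k]

theorem isNoetherianRing_spaceCuspRing : IsNoetherianRing (spaceCuspRing k) := by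
  rw [isNoetherianRing_iff_ideal_fg]
  intro I
  have hinj : Function.Injective (Algebra.linearMap (spaceCuspRing k) k⸨X⸩) :=
    Subtype.val_injective
  refine Submodule.fg_of_fg_map_injective _ hinj ?_
  obtain h | h := fg_or_eq_top (Submodule.map (Algebra.linearMap (spaceCuspRing k) k⸨X⸩) I)
  · exact h
  · have : mono k (-1) ∈ Submodule.map (Algebra.linearMap (spaceCuspRing k) k⸨X⸩) I :=
      h ▸ Submodule.mem_top
    obtain ⟨⟨y, hy⟩, -, hyx⟩ := this
    change y = mono k (-1) at hyx
    have := order_nonneg_of_mem_valRing (spaceCuspRing_le_valRing hy)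
    rw [hyx, order_mono] at this
    omega

variable {k}

theorem isUnit_spaceCuspRing_iff {f : spaceCuspRing k} : IsUnit f ↔ (f : k⸨X⸩).coeff 0 ≠ 0 := by
  obtain ⟨f, hf⟩ := f
  obtain ⟨hV, h1, h2⟩ := mem_spaceCuspRing.1 hf
  constructor
  · intro h h0
    obtain ⟨⟨g, hg⟩, hfg⟩ := h.exists_right_inv
    have hfg : f * g = 1 := congrArg Subtype.val hfg
    have := coeff_mul_zero hV (spaceCuspRing_le_valRing hg)
    change f.coeff 0 = 0 at h0
    rw [hfg, h0] at this
    simp [HahnSeries.coeff_one] at this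
  · intro h0
    change f.coeff 0 ≠ 0 at h0
    have hne : f ≠ 0 := by
      rintro rfl
      simp at h0
    have hinv := inv_mem_valRing hV h0
    have c1 := coeff_mul_one hV hinv
    have c2 := coeff_mul_two hV hinv
    rw [mul_inv_cancel₀ hne, h1] at c1
    rw [mul_inv_cancel₀ hne, h1, h2] at c2
    have hg : f⁻¹ ∈ spaceCuspRing k := mem_spaceCuspRing.2 ⟨hinv,
      by simpa [h0, HahnSeries.coeff_one] using c1, by simpa [h0, HahnSeries.coeff_one] using c2⟩
    exact IsUnit.of_mul_eq_one ⟨f⁻¹, hg⟩ (Subtype.ext (mul_inv_cancel₀ hne))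

variable (k)

instance isLocalRing_spaceCuspRing : IsLocalRing (spaceCuspRing k) := by
  refine IsLocalRing.of_isUnit_or_isUnit_one_sub_self fun f => ?_
  rw [isUnit_spaceCuspRing_iff, isUnit_spaceCuspRing_iff]
  by_cases h : (f : k⸨X⸩).coeff 0 = 0
  · right
    simp [h, HahnSeries.coeff_one]
  · exact Or.inl h

theorem mono_mem_spaceCuspRing {n : ℤ} (hn : 3 ≤ n) : mono k n ∈ spaceCuspRing k :=
  mem_spaceCuspRing_of_order (Or.inr (by rwa [order_mono]))

theorem not_isField_spaceCuspRing : ¬ IsField (spaceCuspRing k) := by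
  intro h
  obtain ⟨⟨y, hy⟩, hxy⟩ := h.mul_inv_cancel
    (a := ⟨mono k 3, mono_mem_spaceCuspRing k le_rfl⟩)
    (fun h => mono_ne_zero 3 (congrArg Subtype.val h))
  have := isUnit_spaceCuspRing_iff.1 (IsUnit.of_mul_eq_one _ hxy)
  simp at this

theorem ringKrullDim_spaceCuspRing : ringKrullDim (spaceCuspRing k) = 1 := by
  rw [ringKrullDim_eq_one_iff_of_isLocalRing_isDomain]
  refine ⟨not_isField_spaceCuspRing k, ?_⟩
  rintro ⟨x, hxR⟩ hx ⟨y, hyR⟩ hy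
  rw [IsLocalRing.mem_maximalIdeal, mem_nonunits_iff, isUnit_spaceCuspRing_iff, not_not] at hy
  obtain ⟨hyV, hy1, hy2⟩ := mem_spaceCuspRing.1 hyR
  have hx0 : x ≠ 0 := fun h => hx (Subtype.ext h)
  have hxo := order_nonneg_of_mem_valRing (spaceCuspRing_le_valRing hxR)
  obtain rfl | hyo := order_ge_three hyV hy hy1 hy2
  · exact zero_mem _
  have hy0 : y ≠ 0 := by
    rintro rfl
    simp at hyo
  refine ⟨x.order.toNat + 1, Ideal.mem_span_singleton'.2 ?_⟩
  refine ⟨⟨y ^ (x.order.toNat + 1) * x⁻¹, mem_spaceCuspRing_of_order (Or.inr ?_)⟩,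
    Subtype.ext (inv_mul_cancel_right₀ hx0 _)⟩
  rw [HahnSeries.order_mul (pow_ne_zero _ hy0) (inv_ne_zero hx0), order_inv hx0,
    HahnSeries.order_pow, nsmul_eq_mul]
  push_cast
  rw [Int.toNat_of_nonneg hxo]
  nlinarith

theorem isFractionRing_spaceCuspRing : IsFractionRing (spaceCuspRing k) k⸨X⸩ := by
  have : FaithfulSMul (spaceCuspRing k) k⸨X⸩ :=
    (faithfulSMul_iff_algebraMap_injective _ _).2 Subtype.val_injective
  refine IsFractionRing.of_field _ _ fun z => ?_
  by_cases hz : z = 0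
  · exact ⟨0, 1, by simp [hz]⟩
  set n : ℤ := 3 + |z.order| with hn
  have h0 := neg_abs_le z.order
  have h1 := abs_nonneg z.order
  refine ⟨⟨z * mono k n, mem_spaceCuspRing_of_order (Or.inr ?_)⟩,
    ⟨mono k n, mono_mem_spaceCuspRing k (by omega)⟩, ?_⟩
  · rw [HahnSeries.order_mul hz (mono_ne_zero n), order_mono]
    omega
  · exact (mul_div_cancel_right₀ z (mono_ne_zero n)).symm

theorem mono_one_notMem_cuspRing : mono k 1 ∉ cuspRing k := fun h => by
  simpa using (mem_cuspRing.1 h).2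

theorem mono_two_mem_cuspRing : mono k 2 ∈ cuspRing k :=
  mem_jetModule_one_zero.1 (mono_two_mem_jetModule 1)

theorem mono_two_notMem_spaceCuspRing : mono k 2 ∉ spaceCuspRing k := fun h => by
  simpa using (mem_spaceCuspRing.1 h).2.2

theorem mono_neg_one_notMem_valRing : mono k (-1) ∉ valRing k := fun h => by
  have := order_nonneg_of_mem_valRing h
  rw [order_mono] at this
  omega

theorem spaceCuspRing_lt_cuspRing : spaceCuspRing k < cuspRing k :=
  lt_of_le_of_ne spaceCuspRing_le_cuspRing fun h =>
    mono_two_notMem_spaceCuspRing k (h ▸ mono_two_mem_cuspRing k)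

theorem cuspRing_lt_valRing : cuspRing k < valRing k :=
  lt_of_le_of_ne cuspRing_le_valRing fun h =>
    mono_one_notMem_cuspRing k (h ▸ mono_mem_valRing zero_le_one)

theorem valRing_lt_top : valRing k < ⊤ :=
  lt_top_iff_ne_top.2 fun h => mono_neg_one_notMem_valRing k (h ▸ Subring.mem_top _)

variable {k}

/-- An overring, viewed as a module over `k[[X³, X⁴, X⁵]]`. -/
def overringModule (T : Subring k⸨X⸩) (hT : spaceCuspRing k ≤ T) :
    Submodule (spaceCuspRing k) k⸨X⸩ where
  carrier := T
  zero_mem' := zero_mem T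
  add_mem' := add_mem
  smul_mem' := fun c _ hx => T.mul_mem (hT c.2) hx

theorem mem_overringModule {T : Subring k⸨X⸩} {hT : spaceCuspRing k ≤ T} {x : k⸨X⸩} :
    x ∈ overringModule T hT ↔ x ∈ T := Iff.rfl

theorem overring_cases {T : Subring k⸨X⸩} (hT : spaceCuspRing k ≤ T) :
    T = spaceCuspRing k ∨ T = cuspRing k ∨ T = valRing k ∨ T = ⊤ := by
  by_cases hV : ∀ f ∈ T, f ∈ valRing k
  · obtain h | ⟨a, b, h⟩ := eq_one_or_eq_jetModule (E := overringModule T hT) T.one_mem hV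
    · left
      ext f
      rw [← mem_overringModule (hT := hT), h, mem_one_iff]
    have hmem : ∀ {f}, f ∈ T ↔ f ∈ jetModule a b := fun {f} => by
      rw [← mem_overringModule (hT := hT), h]
    right
    -- `b X - a X²` lies in `T`, and so does its square, which forces `b ^ 3 = 0`.
    set g : k⸨X⸩ := HahnSeries.C b * mono k 1 + HahnSeries.C (-a) * mono k 2 with hg
    have hgV : g ∈ valRing k := add_mem
      (mul_mem (spaceCuspRing_le_valRing (C_mem_spaceCuspRing b)) (mono_mem_valRing zero_le_one))
      (mul_mem (spaceCuspRing_le_valRing (C_mem_spaceCuspRing (-a))) (mono_mem_valRing zero_le_two))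
    have g0 : g.coeff 0 = 0 := by
      rw [hg, HahnSeries.coeff_add, coeff_C_mul, coeff_C_mul]
      simp
    have g1 : g.coeff 1 = b := by
      rw [hg, HahnSeries.coeff_add, coeff_C_mul, coeff_C_mul]
      simp
    have g2 : g.coeff 2 = -a := by
      rw [hg, HahnSeries.coeff_add, coeff_C_mul, coeff_C_mul]
      simp
    have hgT : g ∈ T := hmem.2 ⟨hgV, by rw [g1, g2]; ring⟩
    have hsq := (hmem.1 (T.mul_mem hgT hgT)).2
    rw [coeff_mul_one hgV hgV, coeff_mul_two hgV hgV, g0, g1, g2] at hsq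
    have hb : b = 0 := by
      have : b ^ 3 = 0 := by linear_combination hsq
      exact pow_eq_zero_iff three_ne_zero |>.1 this
    subst hb
    by_cases ha : a = 0
    · subst ha
      right; left
      ext f
      rw [hmem, mem_jetModule_zero_zero]
    · left
      ext f
      rw [hmem, ← mem_jetModule_one_zero, mem_jetModule, mem_jetModule]
      simp [ha]
  · right; right; right
    push Not at hV
    obtain ⟨x, hx, hxV⟩ := hV
    have ho : x.order < 0 := by
      by_contra! h
      exact hxV (mem_valRing_of_order h)
    have hx0 : x ≠ 0 := by
      rintro rfl
      simp at ho
    have : overringModule T hT = ⊤ := eq_top_of_order_unbounded fun n =>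
      ⟨x ^ n.natAbs, T.pow_mem hx _, pow_ne_zero _ hx0, by
        rw [HahnSeries.order_pow, nsmul_eq_mul]
        have := Int.natCast_natAbs n
        have h2 := neg_abs_le n
        nlinarith [abs_nonneg n]⟩
    rw [eq_top_iff]
    intro f _
    rw [← mem_overringModule (hT := hT), this]
    trivial

variable (k)

theorem overrings_spaceCuspRing :
    overrings (spaceCuspRing k) = {spaceCuspRing k, cuspRing k, valRing k, ⊤} := by
  ext T
  simp only [overrings, Set.mem_ofPred_eq, Set.mem_insert_iff, Set.mem_singleton_iff]
  constructor
  · exact overring_cases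
  · rintro (rfl | rfl | rfl | rfl)
    exacts [le_rfl, spaceCuspRing_le_cuspRing, spaceCuspRing_le_valRing, le_top]

theorem encard_overrings_spaceCuspRing : (overrings (spaceCuspRing k)).encard = 4 := by
  have h1 := spaceCuspRing_lt_cuspRing k
  have h2 := cuspRing_lt_valRing k
  have h3 := valRing_lt_top k
  rw [overrings_spaceCuspRing, Set.encard_insert_of_notMem, Set.encard_insert_of_notMem,
    Set.encard_insert_of_notMem, Set.encard_singleton]
  · norm_num
  · simpa using h3.ne
  · simpa using ⟨h2.ne, (h2.trans h3).ne⟩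
  · simpa using ⟨h1.ne, (h1.trans h2).ne, (h1.trans (h2.trans h3)).ne⟩

/-- The integral closure is an overring containing `X`, whose cube lies in the base; it is not the
whole field, since a domain over which a field is integral is a field. -/
theorem integralClosure_spaceCuspRing :
    (integralClosure (spaceCuspRing k) k⸨X⸩).toSubring = valRing k := by
  have hle : spaceCuspRing k ≤ (integralClosure (spaceCuspRing k) k⸨X⸩).toSubring := fun f hf =>
    isIntegral_algebraMap (R := spaceCuspRing k) (A := k⸨X⸩) (x := ⟨f, hf⟩)
  have hX : mono k 1 ∈ (integralClosure (spaceCuspRing k) k⸨X⸩).toSubring := by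
    refine IsIntegral.of_pow (n := 3) (by norm_num) ?_
    have : mono k 1 ^ 3 = mono k 3 := by
      rw [HahnSeries.single_pow]
      norm_num
    rw [this]
    exact isIntegral_algebraMap (R := spaceCuspRing k) (A := k⸨X⸩)
      (x := ⟨mono k 3, mono_mem_spaceCuspRing k le_rfl⟩)
  obtain h | h | h | h := overring_cases hle
  · rw [h] at hX
    exact absurd (spaceCuspRing_le_cuspRing hX) (mono_one_notMem_cuspRing k)
  · rw [h] at hX
    exact absurd hX (mono_one_notMem_cuspRing k)
  · exact h
  · exfalso
    have : Algebra.IsIntegral (spaceCuspRing k) k⸨X⸩ := ⟨fun x => by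
      have : x ∈ (integralClosure (spaceCuspRing k) k⸨X⸩).toSubring := h ▸ Subring.mem_top x
      exact this⟩
    exact not_isField_spaceCuspRing k
      (isField_of_isIntegral_of_isField (R := spaceCuspRing k) (S := k⸨X⸩) Subtype.val_injective
        (Field.toIsField k⸨X⸩))

end RingStructure

/-! ### Divisorial closure over proper overrings -/

section Divisorial

variable {k : Type u} [Field k]

theorem mem_valRing_of_mono_mul {x : k⸨X⸩} (h2 : x * mono k 2 ∈ cuspRing k)
    (h3 : x * mono k 3 ∈ cuspRing k) : x ∈ valRing k := by
  rw [mul_comm, mem_cuspRing] at h2 h3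
  refine mem_valRing_of_coeff fun n hn => ?_
  obtain h | rfl | rfl : n < -2 ∨ n = -2 ∨ n = -1 := by omega
  · have := coeff_eq_zero_of_mem_valRing h2.1 (n := n + 2) (by omega)
    rwa [coeff_mono_mul, add_sub_cancel_right] at this
  · have := h3.2
    rwa [coeff_mono_mul] at this
  · have := h2.2
    rwa [coeff_mono_mul] at this

/-- Over an overring other than `k[[X³, X⁴, X⁵]]` itself, every nonzero submodule of `k((X))`,
fractional or not, equals its divisorial closure. -/
theorem vClosure_eq_self_of_overring {T : Subring k⸨X⸩} (hT : spaceCuspRing k ≤ T)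
    (hne : T ≠ spaceCuspRing k) {I : Submodule T k⸨X⸩} (hI : I ≠ ⊥) : vClosure T I = I := by
  refine le_antisymm (fun x hx => ?_) (le_vClosure I)
  rw [mem_vClosure] at hx
  let E : Submodule (spaceCuspRing k) k⸨X⸩ :=
    { carrier := I
      zero_mem' := I.zero_mem
      add_mem' := I.add_mem
      smul_mem' := fun c y hy => I.smul_mem (⟨c, hT c.2⟩ : T) hy }
  have hmem : ∀ {y}, y ∈ E ↔ y ∈ I := Iff.rfl
  have hTI : ∀ {t y}, t ∈ T → y ∈ I → t * y ∈ I := fun {t y} ht hy => I.smul_mem (⟨t, ht⟩ : T) hy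
  have hE : E ≠ ⊥ := by
    obtain ⟨y, hy, hy0⟩ := (Submodule.ne_bot_iff I).1 hI
    exact (Submodule.ne_bot_iff E).2 ⟨y, hy, hy0⟩
  obtain h | ⟨a, ha, F, hEF, h1, hF⟩ := exists_normalized hE
  · rw [← hmem, h]
    trivial
  have hIF : ∀ {y}, y ∈ I ↔ a⁻¹ * y ∈ F := fun {y} => by rw [← hmem, hEF, mem_smul_iff ha]
  have hTF : ∀ {t y}, t ∈ T → y ∈ F → t * y ∈ F := fun {t y} ht hy => by
    have := hIF.1 (hTI ht ((hIF (y := a * y)).2 (by rwa [inv_mul_cancel_left₀ ha])))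
    rwa [mul_left_comm, inv_mul_cancel_left₀ ha] at this
  have hTsub : ∀ t ∈ T, t ∈ F := fun t ht => by simpa using hTF ht h1
  have hcases : T = cuspRing k ∨ T = valRing k := by
    obtain h | h | h | h := overring_cases hT
    · exact absurd h hne
    · exact Or.inl h
    · exact Or.inr h
    · exact absurd (hF _ (hTsub (mono k (-1)) (h ▸ Subring.mem_top _)))
        (mono_neg_one_notMem_valRing k)
  rw [hIF]
  by_cases hFT : ∀ f ∈ F, f ∈ T
  · have := hx a⁻¹ fun e he => hFT _ (hIF.1 he)
    rw [mul_comm] at this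
    exact hTsub _ this
  obtain rfl | rfl := hcases
  · -- Here `F` lies strictly above `k[[X², X³]]`, so it is `k[[X]]`, with dual `X² k[[X]]`.
    push Not at hFT
    obtain ⟨f, hf, hfT⟩ := hFT
    have hX : mono k 1 ∈ F := by
      have hf1 : f.coeff 1 ≠ 0 := fun h => hfT (mem_cuspRing.2 ⟨hF f hf, h⟩)
      have hf' : f - HahnSeries.C (f.coeff 1) * mono k 1 ∈ cuspRing k := mem_cuspRing.2
        ⟨sub_mem (hF f hf) (mul_mem (spaceCuspRing_le_valRing (C_mem_spaceCuspRing _))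
          (mono_mem_valRing zero_le_one)), by
          rw [HahnSeries.coeff_sub, coeff_C_mul]
          simp⟩
      have := mul_mem_of_mem (C_mem_spaceCuspRing (f.coeff 1)⁻¹) (F.sub_mem hf (hTsub _ hf'))
      rwa [sub_sub_cancel, ← mul_assoc, ← map_mul, inv_mul_cancel₀ hf1, map_one, one_mul] at this
    have hdual : ∀ n : ℤ, 2 ≤ n → x * (a⁻¹ * mono k n) ∈ cuspRing k := fun n hn => by
      refine hx _ fun e he => ?_
      have he' := hF _ (hIF.1 he)
      rw [mul_right_comm, mul_comm, mem_cuspRing]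
      refine ⟨mul_mem (mono_mem_valRing (by omega)) he', ?_⟩
      rw [coeff_mono_mul]
      exact coeff_eq_zero_of_mem_valRing he' (by omega)
    have hval : a⁻¹ * x ∈ valRing k := by
      refine mem_valRing_of_mono_mul ?_ ?_
      · rw [mul_right_comm, mul_comm]
        exact hdual 2 le_rfl
      · rw [mul_right_comm, mul_comm]
        exact hdual 3 (by norm_num)
    exact mem_of_generators hval h1 (Or.inr hX) (Or.inr (hTsub _ (mono_two_mem_cuspRing k)))
  · exact absurd hF hFT

end Divisorial

/-! ### Semistar operations -/

section SemistarOperations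

variable {k : Type u} [Field k]

theorem mul_mem_toFun {R : Subring k⸨X⸩} (s : SemistarOperation R) {E F : NonzeroSubmodule R}
    {a x : k⸨X⸩} (h : ∀ e ∈ E.1, a * e ∈ F.1) (hx : x ∈ (s.toFun E).1) :
    a * x ∈ (s.toFun F).1 := by
  by_cases ha : a = 0
  · rw [ha, zero_mul]
    exact zero_mem _
  have hle : E.scale a ha ≤ F := by
    intro y hy
    obtain ⟨e, he, rfl⟩ := (Submodule.mem_smul_pointwise_iff_exists _ _ _).1 hy
    exact h e he
  have := s.monotone _ _ hle
  rw [s.map_scale] at this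
  exact this (Submodule.smul_mem_pointwise_smul x a _ hx)

theorem toFun_mem_of_le {R : Subring k⸨X⸩} (s : SemistarOperation R) {E F : NonzeroSubmodule R}
    {x : k⸨X⸩} (h : E.1 ≤ F.1) (hx : x ∈ (s.toFun E).1) : x ∈ (s.toFun F).1 :=
  s.monotone E F h hx

/-- The closure of a ring is a ring. -/
theorem mul_mem_toFun_of_mul_mem {R : Subring k⸨X⸩} (s : SemistarOperation R)
    {E : NonzeroSubmodule R} (hE : ∀ x ∈ E.1, ∀ y ∈ E.1, x * y ∈ E.1) {x y : k⸨X⸩}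
    (hx : x ∈ (s.toFun E).1) (hy : y ∈ (s.toFun E).1) : x * y ∈ (s.toFun E).1 := by
  have h1 : ∀ e ∈ E.1, x * e ∈ (s.toFun E).1 := fun e he => by
    rw [mul_comm]
    exact mul_mem_toFun s (hE e he) hx
  have h2 := mul_mem_toFun s h1 hy
  rwa [s.idempotent] at h2

/-- Every submodule is finitely generated or the whole field, and the whole field is the union of
its nonzero finitely generated submodules. -/
theorem isFiniteCharacter_spaceCuspRing (s : SemistarOperation (spaceCuspRing k)) :
    s.IsFiniteCharacter := by
  intro E x
  constructor
  · intro hx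
    obtain h | h := fg_or_eq_top E.1
    · exact ⟨E, ⟨h, le_rfl⟩, hx⟩
    · have hF : Submodule.span (spaceCuspRing k) {1, x} ≠ ⊥ :=
        (Submodule.ne_bot_iff _).2 ⟨1, Submodule.subset_span (by simp), one_ne_zero⟩
      refine ⟨⟨_, hF⟩, ⟨Submodule.fg_span (by simp), ?_⟩,
        s.le_closure ⟨_, hF⟩ (Submodule.subset_span (by simp))⟩
      change Submodule.span (spaceCuspRing k) {1, x} ≤ E.1
      rw [h]
      exact le_top
  · rintro ⟨F, ⟨-, hFE⟩, hx⟩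
    exact s.monotone F E hFE hx

theorem semistarT_eq_semistarV : semistarT (spaceCuspRing k) = semistarV (spaceCuspRing k) := by
  ext E x
  exact (isFiniteCharacter_spaceCuspRing (semistarV (spaceCuspRing k)) E x).symm

theorem ne_bot_of_one_mem {R : Subring k⸨X⸩} {E : Submodule R k⸨X⸩} (h : (1 : k⸨X⸩) ∈ E) :
    E ≠ ⊥ :=
  (Submodule.ne_bot_iff _).2 ⟨1, h, one_ne_zero⟩

variable (k) in
/-- The ring `k[[X³, X⁴, X⁵]]`, as a nonzero module over itself. -/
noncomputable def oneNz : NonzeroSubmodule (spaceCuspRing k) :=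
  ⟨1, ne_bot_of_one_mem (mem_one_iff.2 (one_mem _))⟩

/-- The nonzero module `jetModule a b`. -/
noncomputable def jetNz (a b : k) : NonzeroSubmodule (spaceCuspRing k) :=
  ⟨jetModule a b, ne_bot_of_one_mem (one_mem_jetModule a b)⟩

theorem mem_oneNz {f : k⸨X⸩} : f ∈ (oneNz k).1 ↔ f ∈ spaceCuspRing k := mem_one_iff

theorem oneNz_le_jetNz (a b : k) : (oneNz k).1 ≤ (jetNz a b).1 := fun f hf => by
  have := mul_mem_of_mem (mem_oneNz.1 hf) (one_mem_jetModule a b)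
  rwa [mul_one] at this

theorem toFun_ring_cases (s : SemistarOperation (spaceCuspRing k))
    {E : NonzeroSubmodule (spaceCuspRing k)} (h1 : (1 : k⸨X⸩) ∈ E.1)
    (hE : ∀ x ∈ E.1, ∀ y ∈ E.1, x * y ∈ E.1) :
    (s.toFun E).1 = 1 ∨ (s.toFun E).1 = jetModule 1 0 ∨ (s.toFun E).1 = jetModule 0 0 ∨
      (s.toFun E).1 = ⊤ := by
  let T : Subring k⸨X⸩ :=
    { carrier := (s.toFun E).1
      mul_mem' := mul_mem_toFun_of_mul_mem s hE
      one_mem' := s.le_closure E h1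
      add_mem' := add_mem
      zero_mem' := zero_mem _
      neg_mem' := neg_mem }
  have hmem : ∀ {x}, x ∈ T ↔ x ∈ (s.toFun E).1 := Iff.rfl
  have hT : spaceCuspRing k ≤ T := fun f hf => by
    have := mul_mem_of_mem hf (s.le_closure E h1)
    rwa [mul_one] at this
  refine (overring_cases hT).imp (fun h => ?_) (Or.imp (fun h => ?_) (Or.imp (fun h => ?_)
    fun h => ?_)) <;> ext f <;> rw [← hmem, h]
  · exact mem_one_iff.symm
  · exact mem_jetModule_one_zero.symm
  · exact mem_jetModule_zero_zero.symm
  · exact ⟨fun _ => trivial, fun _ => trivial⟩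

theorem toFun_eq_top (s : SemistarOperation (spaceCuspRing k))
    (h : (s.toFun (oneNz k)).1 = ⊤) {E : NonzeroSubmodule (spaceCuspRing k)}
    (hE : (oneNz k).1 ≤ E.1) : (s.toFun E).1 = ⊤ :=
  eq_top_iff.2 fun _ _ => toFun_mem_of_le s hE (h ▸ Submodule.mem_top)

/-- Unless every module is sent to the whole field, `k[[X]]` is closed: otherwise the conductor
`X³ k[[X]]`, and with it the base ring, would have the whole field as closure. -/
theorem toFun_jetNz_zero_zero (s : SemistarOperation (spaceCuspRing k))
    (h : (s.toFun (oneNz k)).1 ≠ ⊤) : (s.toFun (jetNz 0 0)).1 = jetModule 0 0 := by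
  have hX : mono k 1 ∈ (s.toFun (jetNz 0 0)).1 := s.le_closure _ (mono_one_mem_jetModule 0)
  obtain e | e | e | e := toFun_ring_cases s (E := jetNz 0 0) (one_mem_jetModule 0 0)
    (fun x hx y hy => mem_jetModule_zero_zero.2
      (mul_mem (mem_jetModule_zero_zero.1 hx) (mem_jetModule_zero_zero.1 hy)))
  · rw [e, mem_one_iff] at hX
    exact absurd (spaceCuspRing_le_cuspRing hX) (mono_one_notMem_cuspRing k)
  · rw [e, mem_jetModule_one_zero] at hX
    exact absurd hX (mono_one_notMem_cuspRing k)
  · exact e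
  · refine absurd (eq_top_iff.2 fun z _ => ?_) h
    have := mul_mem_toFun s (E := jetNz 0 0) (F := oneNz k) (a := mono k 3)
      (x := (mono k 3)⁻¹ * z) (fun f hf => ?_) (e ▸ Submodule.mem_top)
    · rwa [mul_inv_cancel_left₀ (mono_ne_zero 3)] at this
    · rw [mem_oneNz, mem_spaceCuspRing, coeff_mono_mul, coeff_mono_mul]
      exact ⟨mul_mem (mono_mem_valRing (by norm_num)) hf.1,
        coeff_eq_zero_of_mem_valRing hf.1 (by norm_num),
        coeff_eq_zero_of_mem_valRing hf.1 (by norm_num)⟩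

/-- The values of a semistar operation at the modules generated by `1`, by `1, X²` and by `1, X`;
they determine the operation. -/
noncomputable def SemistarOperation.profile (s : SemistarOperation (spaceCuspRing k)) :
    Submodule (spaceCuspRing k) k⸨X⸩ × Submodule (spaceCuspRing k) k⸨X⸩ ×
      Submodule (spaceCuspRing k) k⸨X⸩ :=
  ((s.toFun (oneNz k)).1, (s.toFun (jetNz 1 0)).1, (s.toFun (jetNz 0 1)).1)

theorem profile_injective :
    Function.Injective (SemistarOperation.profile (k := k)) := by
  intro s s' h
  simp only [SemistarOperation.profile, Prod.mk.injEq] at h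
  obtain ⟨h1, h2, h3⟩ := h
  have h4 : (s.toFun (jetNz 0 0)).1 = (s'.toFun (jetNz 0 0)).1 := by
    by_cases ht : (s.toFun (oneNz k)).1 = ⊤
    · rw [toFun_eq_top s ht (oneNz_le_jetNz 0 0), toFun_eq_top s' (h1 ▸ ht) (oneNz_le_jetNz 0 0)]
    · rw [toFun_jetNz_zero_zero s ht, toFun_jetNz_zero_zero s' (h1 ▸ ht)]
  refine SemistarOperation.ext (funext fun E => ?_)
  obtain hE | ⟨a, ha, F, hE, hF⟩ := submodule_classification E.2
  · have : ∀ t : SemistarOperation (spaceCuspRing k), (t.toFun E).1 = ⊤ := fun t =>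
      top_le_iff.1 (hE ▸ t.le_closure E)
    exact Subtype.ext ((this s).trans (this s').symm)
  · have key : ∀ G : NonzeroSubmodule (spaceCuspRing k), G.1 = F →
        (s.toFun G).1 = (s'.toFun G).1 → s.toFun E = s'.toFun E := by
      intro G hG hss
      have : E = G.scale a ha := Subtype.ext (by rw [hE, ← hG]; rfl)
      rw [this, s.map_scale, s'.map_scale, Subtype.ext hss]
    obtain rfl | rfl | rfl | rfl := hF
    exacts [key (oneNz k) rfl h1, key (jetNz 1 0) rfl h2, key (jetNz 0 1) rfl h3,
      key (jetNz 0 0) rfl h4]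

theorem jetModule_le_zero_zero (a b : k) : jetModule a b ≤ jetModule 0 0 := fun _ hf =>
  mem_jetModule_zero_zero.2 hf.1

theorem jetModule_zero_zero_le {E : Submodule (spaceCuspRing k) k⸨X⸩} (h0 : (1 : k⸨X⸩) ∈ E)
    (h1 : mono k 1 ∈ E) (h2 : mono k 2 ∈ E) : jetModule 0 0 ≤ E := fun _ hf =>
  mem_of_generators hf.1 h0 (Or.inr h1) (Or.inr h2)

theorem profile_cases (s : SemistarOperation (spaceCuspRing k)) :
    s.profile = (⊤, ⊤, ⊤) ∨ s.profile = (jetModule 0 0, jetModule 0 0, jetModule 0 0) ∨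
      s.profile = (jetModule 1 0, jetModule 1 0, jetModule 0 0) ∨
      s.profile = (1, jetModule 0 0, jetModule 0 0) ∨
      s.profile = (1, jetModule 1 0, jetModule 0 0) ∨
      s.profile = (1, jetModule 1 0, jetModule 0 1) := by
  by_cases ht : (s.toFun (oneNz k)).1 = ⊤
  · left
    simp only [SemistarOperation.profile, ht, toFun_eq_top s ht (oneNz_le_jetNz _ _)]
  right
  have hV := toFun_jetNz_zero_zero s ht
  have hle : ∀ a b : k, (s.toFun (jetNz a b)).1 ≤ jetModule 0 0 := fun a b x hx =>
    hV ▸ toFun_mem_of_le s (F := jetNz 0 0) (jetModule_le_zero_zero a b) hx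
  have hge : ∀ a b : k, (s.toFun (oneNz k)).1 ≤ (s.toFun (jetNz a b)).1 := fun a b x hx =>
    toFun_mem_of_le s (oneNz_le_jetNz a b) hx
  have h1 : ∀ a b : k, (1 : k⸨X⸩) ∈ (s.toFun (jetNz a b)).1 := fun a b =>
    s.le_closure (jetNz a b) (one_mem_jetModule a b)
  have hX2 : mono k 2 ∈ (s.toFun (jetNz 1 0)).1 := s.le_closure _ (mono_two_mem_jetModule 1)
  have hX : mono k 1 ∈ (s.toFun (jetNz 0 1)).1 := s.le_closure _ (mono_one_mem_jetModule 1)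
  have hN : mono k 2 ∈ (s.toFun (jetNz 0 1)).1 → (s.toFun (jetNz 0 1)).1 = jetModule 0 0 :=
    fun h => (hle 0 1).antisymm (jetModule_zero_zero_le (h1 0 1) hX h)
  obtain e | e | e | e := toFun_ring_cases s (E := oneNz k) (mem_oneNz.2 (one_mem _))
    (fun x hx y hy => mem_oneNz.2 (mul_mem (mem_oneNz.1 hx) (mem_oneNz.1 hy)))
  · right; right
    have hN' : mono k 2 ∉ (s.toFun (jetNz 0 1)).1 → (s.toFun (jetNz 0 1)).1 = jetModule 0 1 := by
      refine fun h => le_antisymm (fun f hf => ?_) (s.le_closure (jetNz 0 1))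
      refine mem_jetModule_zero_one.2 ⟨(hle 0 1 hf).1, ?_⟩
      by_contra hf2
      -- A series with `f₂ ≠ 0` generates `X²` modulo the module generated by `1` and `X`.
      have hg : HahnSeries.C (f.coeff 2) * mono k 2 - f ∈ (s.toFun (jetNz 0 1)).1 := by
        refine s.le_closure (jetNz 0 1) (mem_jetModule_zero_one.2 ⟨sub_mem (mul_mem
          (spaceCuspRing_le_valRing (C_mem_spaceCuspRing _)) (mono_mem_valRing zero_le_two))
          (hle 0 1 hf).1, ?_⟩)
        rw [HahnSeries.coeff_sub, coeff_C_mul]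
        simp
      have := mul_mem_of_mem (C_mem_spaceCuspRing (f.coeff 2)⁻¹) (add_mem hg hf)
      rw [sub_add_cancel, ← mul_assoc, ← map_mul, inv_mul_cancel₀ hf2, map_one, one_mul] at this
      exact h this
    obtain e' | e' | e' | e' := toFun_ring_cases s (E := jetNz 1 0) (one_mem_jetModule 1 0)
      (fun x hx y hy => mem_jetModule_one_zero.2
        (mul_mem (mem_jetModule_one_zero.1 hx) (mem_jetModule_one_zero.1 hy)))
    · rw [e', mem_one_iff] at hX2
      exact absurd hX2 (mono_two_notMem_spaceCuspRing k)
    · right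
      by_cases h : mono k 2 ∈ (s.toFun (jetNz 0 1)).1
      · left
        simp only [SemistarOperation.profile, e, e', hN h]
      · right
        simp only [SemistarOperation.profile, e, e', hN' h]
    · -- Multiplication by `X` maps `k[[X², X³]]` into the module generated by `1` and `X`.
      left
      have h : mono k 2 ∈ (s.toFun (jetNz 0 1)).1 := by
        have := mul_mem_toFun s (E := jetNz 1 0) (F := jetNz 0 1) (a := mono k 1) (x := mono k 1)
          (fun f hf => ?_) (e' ▸ mono_one_mem_jetModule 0)
        · simpa [one_add_one_eq_two] using this
        · obtain ⟨hf, hf1⟩ := mem_cuspRing.1 (mem_jetModule_one_zero.1 hf)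
          refine mem_jetModule_zero_one.2 ⟨mul_mem (mono_mem_valRing zero_le_one) hf, ?_⟩
          rw [coeff_mono_mul]
          exact hf1
      simp only [SemistarOperation.profile, e, e', hN h]
    · have := e' ▸ hle 1 0
      exact absurd (this (Submodule.mem_top (x := mono k (-1)))).1 (mono_neg_one_notMem_valRing k)
  · right; left
    have hc : (s.toFun (jetNz 1 0)).1 = jetModule 1 0 := by
      have : s.toFun (oneNz k) = jetNz 1 0 := Subtype.ext e
      rw [← this, s.idempotent, this]
      rfl
    simp only [SemistarOperation.profile, e, hc, hN (hge 0 1 (e ▸ mono_two_mem_jetModule 1))]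
  · left
    have : ∀ a b : k, (s.toFun (jetNz a b)).1 = jetModule 0 0 := fun a b =>
      (hle a b).antisymm (e ▸ hge a b)
    simp only [SemistarOperation.profile, e, this]
  · exact absurd e ht

theorem span_overring_eq {T : Subring k⸨X⸩} (hT : spaceCuspRing k ≤ T) :
    Submodule.span (spaceCuspRing k) (T : Set k⸨X⸩) = overringModule T hT :=
  le_antisymm (Submodule.span_le.2 fun _ h => h) Submodule.subset_span

theorem semistarExtend_one {T : Subring k⸨X⸩} (hT : spaceCuspRing k ≤ T) :
    ((semistarExtend (spaceCuspRing k) T).toFun (oneNz k)).1 = overringModule T hT := by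
  change 1 * Submodule.span (spaceCuspRing k) (T : Set k⸨X⸩) = _
  rw [one_mul, span_overring_eq hT]

theorem mem_vClosure_of_mem {E : Submodule (spaceCuspRing k) k⸨X⸩} (h1 : (1 : k⸨X⸩) ∈ E)
    (h : mono k 1 ∈ E ∨ mono k 2 ∈ E) {x : k⸨X⸩} (hx : x ∈ valRing k) :
    x ∈ vClosure (spaceCuspRing k) E := by
  rw [mem_vClosure]
  intro y hy
  -- The dual of `E` is the conductor `X³ k[[X]]`.
  have hyR := hy 1 h1
  rw [mul_one] at hyR
  obtain ⟨hyV, hy1, hy2⟩ := mem_spaceCuspRing.1 hyR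
  have hy0 : y.coeff 0 = 0 := by
    obtain h | h := h
    · have := (mem_spaceCuspRing.1 (hy _ h)).2.1
      rwa [mul_comm, coeff_mono_mul, sub_self] at this
    · have := (mem_spaceCuspRing.1 (hy _ h)).2.2
      rwa [mul_comm, coeff_mono_mul, sub_self] at this
  refine mem_spaceCuspRing.2 ⟨mul_mem hx hyV, ?_, ?_⟩
  · rw [coeff_mul_one hx hyV, hy0, hy1]
    ring
  · rw [coeff_mul_two hx hyV, hy0, hy1, hy2]
    ring

theorem mono_one_mem_vClosure_jetNz :
    mono k 1 ∈ vClosure (spaceCuspRing k) (jetModule (1 : k) 0) :=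
  mem_vClosure_of_mem (one_mem_jetModule 1 0) (Or.inr (mono_two_mem_jetModule 1))
    (mono_mem_valRing zero_le_one)

theorem vClosure_one {R : Subring k⸨X⸩} : vClosure R 1 = 1 := by
  refine le_antisymm (fun x hx => ?_) (le_vClosure 1)
  have := mem_vClosure.1 hx 1 fun e he => by
    obtain ⟨r, rfl⟩ := Submodule.mem_one.1 he
    rw [one_mul]
    exact r.2
  rw [mul_one] at this
  exact Submodule.mem_one.2 ⟨⟨x, this⟩, rfl⟩

theorem mono_two_notMem_one : mono k 2 ∉ (1 : Submodule (spaceCuspRing k) k⸨X⸩) := fun h =>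
  mono_two_notMem_spaceCuspRing k (mem_one_iff.1 h)

theorem mono_one_notMem_jetModule : mono k 1 ∉ jetModule (1 : k) 0 := fun h =>
  mono_one_notMem_cuspRing k (mem_jetModule_one_zero.1 h)

theorem mono_two_notMem_jetModule : mono k 2 ∉ jetModule (0 : k) 1 := fun h => by
  simpa using (mem_jetModule_zero_one.1 h).2

theorem mono_neg_one_notMem_jetModule (a b : k) : mono k (-1) ∉ jetModule a b := fun h =>
  mono_neg_one_notMem_valRing k h.1

theorem one_ne_jetModule (a : k) : (1 : Submodule (spaceCuspRing k) k⸨X⸩) ≠ jetModule a 0 :=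
  fun h => mono_two_notMem_one (h ▸ mono_two_mem_jetModule a)

theorem jetModule_one_zero_ne : jetModule (1 : k) 0 ≠ jetModule 0 0 := fun h =>
  mono_one_notMem_jetModule (h ▸ mono_one_mem_jetModule 0)

theorem jetModule_zero_one_ne : jetModule (0 : k) 1 ≠ jetModule 0 0 := fun h =>
  mono_two_notMem_jetModule (h ▸ mono_two_mem_jetModule 0)

theorem jetModule_ne_top (a b : k) : jetModule a b ≠ ⊤ := fun h =>
  mono_neg_one_notMem_jetModule a b (h ▸ Submodule.mem_top)

theorem one_ne_top : (1 : Submodule (spaceCuspRing k) k⸨X⸩) ≠ ⊤ := fun h =>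
  mono_two_notMem_one (h ▸ Submodule.mem_top)

variable (k)

theorem profile_semistarE : (semistarE (spaceCuspRing k)).profile = (⊤, ⊤, ⊤) := rfl

theorem profile_semistarD :
    (semistarD (spaceCuspRing k)).profile = (1, jetModule 1 0, jetModule 0 1) := rfl

theorem profile_semistarExtend_valRing : (semistarExtend (spaceCuspRing k) (valRing k)).profile =
    (jetModule 0 0, jetModule 0 0, jetModule 0 0) := by
  have h : ((semistarExtend (spaceCuspRing k) (valRing k)).toFun (oneNz k)).1 = jetModule 0 0 := by
    rw [semistarExtend_one spaceCuspRing_le_valRing]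
    ext f
    exact mem_jetModule_zero_zero.symm
  obtain e | e | e | e | e | e := profile_cases (semistarExtend (spaceCuspRing k) (valRing k)) <;>
    have e1 := h.symm.trans (congrArg Prod.fst e)
  · exact absurd e1 (jetModule_ne_top 0 0)
  · exact e
  · exact absurd e1.symm jetModule_one_zero_ne
  all_goals exact absurd e1.symm (one_ne_jetModule 0)

theorem profile_semistarExtend_cuspRing :
    (semistarExtend (spaceCuspRing k) (cuspRing k)).profile =
      (jetModule 1 0, jetModule 1 0, jetModule 0 0) := by
  have h : ((semistarExtend (spaceCuspRing k) (cuspRing k)).toFun (oneNz k)).1 =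
      jetModule 1 0 := by
    rw [semistarExtend_one spaceCuspRing_le_cuspRing]
    ext f
    exact mem_jetModule_one_zero.symm
  obtain e | e | e | e | e | e := profile_cases (semistarExtend (spaceCuspRing k) (cuspRing k)) <;>
    have e1 := h.symm.trans (congrArg Prod.fst e)
  · exact absurd e1 (jetModule_ne_top 1 0)
  · exact absurd e1 jetModule_one_zero_ne
  · exact e
  all_goals exact absurd e1.symm (one_ne_jetModule 1)

theorem profile_semistarV :
    (semistarV (spaceCuspRing k)).profile = (1, jetModule 0 0, jetModule 0 0) := by
  have h : ((semistarV (spaceCuspRing k)).toFun (oneNz k)).1 = 1 := vClosure_one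
  have h' : mono k 1 ∈ ((semistarV (spaceCuspRing k)).toFun (jetNz 1 0)).1 :=
    mono_one_mem_vClosure_jetNz
  obtain e | e | e | e | e | e := profile_cases (semistarV (spaceCuspRing k)) <;>
    have e1 := h.symm.trans (congrArg Prod.fst e) <;>
    have e2 : ((semistarV (spaceCuspRing k)).toFun (jetNz 1 0)).1 = _ :=
      congrArg (fun p => p.2.1) e
  · exact absurd e1 one_ne_top
  · exact absurd e1 (one_ne_jetModule 0)
  · exact absurd e1 (one_ne_jetModule 1)
  · exact e
  all_goals exact absurd (e2 ▸ h') mono_one_notMem_jetModule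

theorem profile_semistarT :
    (semistarT (spaceCuspRing k)).profile = (1, jetModule 0 0, jetModule 0 0) := by
  rw [semistarT_eq_semistarV, profile_semistarV]

theorem profile_semistarExtend_meet_semistarV :
    ((semistarExtend (spaceCuspRing k) (cuspRing k)).meet (semistarV (spaceCuspRing k))).profile =
      (1, jetModule 1 0, jetModule 0 0) := by
  have hT := profile_semistarExtend_cuspRing k
  have hV := profile_semistarV k
  simp only [SemistarOperation.profile, Prod.mk.injEq] at hT hV ⊢
  refine ⟨?_, ?_, ?_⟩
  · change _ ⊓ _ = _
    rw [hT.1, hV.1]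
    exact inf_eq_right.2 (oneNz_le_jetNz 1 0)
  · change _ ⊓ _ = _
    rw [hT.2.1, hV.2.1]
    exact inf_eq_left.2 (jetModule_le_zero_zero 1 0)
  · change _ ⊓ _ = _
    rw [hT.2.2, hV.2.2, inf_idem]

theorem SSFc_spaceCuspRing : SSFc (spaceCuspRing k) =
    {semistarE (spaceCuspRing k), semistarD (spaceCuspRing k),
      (semistarExtend (spaceCuspRing k) (cuspRing k)).meet (semistarV (spaceCuspRing k)),
      semistarT (spaceCuspRing k), semistarExtend (spaceCuspRing k) (cuspRing k),
      semistarExtend (spaceCuspRing k) (valRing k)} := by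
  ext s
  refine ⟨fun _ => ?_, fun _ => isFiniteCharacter_spaceCuspRing s⟩
  simp only [Set.mem_insert_iff, Set.mem_singleton_iff, ← profile_injective.eq_iff,
    profile_semistarE, profile_semistarD, profile_semistarExtend_meet_semistarV, profile_semistarT,
    profile_semistarExtend_cuspRing, profile_semistarExtend_valRing]
  have := profile_cases s
  tauto

theorem encard_SSFc_spaceCuspRing : (SSFc (spaceCuspRing k)).encard = 6 := by
  have h0 := one_ne_jetModule (0 : k)
  have h1 := one_ne_jetModule (1 : k)
  have h2 := jetModule_one_zero_ne (k := k)
  have h3 := jetModule_zero_one_ne (k := k)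
  have h4 := jetModule_ne_top (k := k)
  have h5 := one_ne_top (k := k)
  rw [SSFc_spaceCuspRing, Set.encard_insert_of_notMem, Set.encard_insert_of_notMem,
    Set.encard_insert_of_notMem, Set.encard_insert_of_notMem, Set.encard_insert_of_notMem,
    Set.encard_singleton]
  · norm_num
  all_goals
    simp only [Set.mem_insert_iff, Set.mem_singleton_iff, ← profile_injective.eq_iff,
      profile_semistarE, profile_semistarD, profile_semistarExtend_meet_semistarV,
      profile_semistarT, profile_semistarExtend_cuspRing, profile_semistarExtend_valRing,
      Prod.mk.injEq]
    simp [h0, h1, h2, h3, h2.symm, (h4 _ _).symm, h5.symm]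

theorem not_isDivisorialDomain_spaceCuspRing : ¬ IsDivisorialDomain (spaceCuspRing k) := by
  intro h
  have hfrac : IsFractional (nonZeroDivisors (spaceCuspRing k)) (jetModule (1 : k) 0) := by
    refine ⟨⟨mono k 3, mono_mem_spaceCuspRing k le_rfl⟩,
      mem_nonZeroDivisors_of_ne_zero fun h => mono_ne_zero 3 (congrArg Subtype.val h),
      fun f hf => ⟨⟨mono k 3 * f, mem_spaceCuspRing.2 ⟨mul_mem (mono_mem_valRing (by norm_num)) hf.1,
        ?_, ?_⟩⟩, rfl⟩⟩
    · rw [coeff_mono_mul]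
      exact coeff_eq_zero_of_mem_valRing hf.1 (by norm_num)
    · rw [coeff_mono_mul]
      exact coeff_eq_zero_of_mem_valRing hf.1 (by norm_num)
  have hv := h (jetModule 1 0) (jetNz 1 0).2 hfrac
  exact mono_one_notMem_jetModule (hv ▸ mono_one_mem_vClosure_jetNz (k := k))

end SemistarOperations

theorem mainTheorem2 (k : Type u) [Field k] (R R₁ R₂ : Subring k⸨X⸩)
    (hR : R = powerSeriesIn k {3, 4, 5}) (hR₁ : R₁ = powerSeriesIn k {2, 3})
    (hR₂ : R₂ = (HahnSeries.ofPowerSeries ℤ k).range) :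
    -- R is a one-dimensional Noetherian local domain with quotient field k((X)), not divisorial
    IsDomain R ∧ IsNoetherianRing R ∧ IsLocalRing R ∧ ringKrullDim R = 1 ∧
    IsFractionRing R k⸨X⸩ ∧ ¬ IsDivisorialDomain R ∧
    -- its overrings
    R < R₁ ∧ R₁ < R₂ ∧ R₂ < ⊤ ∧ overrings R = {R, R₁, R₂, ⊤} ∧
    (integralClosure R k⸨X⸩).toSubring = R₂ ∧
    (∀ T ∈ overrings R, T ≠ R → IsDivisorialDomain T ∧ IsFgvDomain T) ∧
    (overrings R).encard = 4 ∧
    ((overrings R).encard : WithBot ℕ∞) = 3 + ringKrullDim R ∧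
    -- its semistar operations of finite character
    SSFc R = {semistarE R, semistarD R, (semistarExtend R R₁).meet (semistarV R), semistarT R,
      semistarExtend R R₁, semistarExtend R R₂} ∧
    (SSFc R).encard = 6 ∧
    ((SSFc R).encard : WithBot ℕ∞) = 5 + ringKrullDim R := by
  subst hR hR₁ hR₂
  refine ⟨inferInstance, isNoetherianRing_spaceCuspRing k, isLocalRing_spaceCuspRing k,
    ringKrullDim_spaceCuspRing k, isFractionRing_spaceCuspRing k,
    not_isDivisorialDomain_spaceCuspRing k, spaceCuspRing_lt_cuspRing k, cuspRing_lt_valRing k,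
    valRing_lt_top k, overrings_spaceCuspRing k, integralClosure_spaceCuspRing k,
    fun T hT hne => ⟨fun I hI _ => vClosure_eq_self_of_overring hT hne hI,
      fun I hI _ => vClosure_eq_self_of_overring hT hne hI⟩,
    encard_overrings_spaceCuspRing k, ?_, SSFc_spaceCuspRing k, encard_SSFc_spaceCuspRing k, ?_⟩
  · rw [encard_overrings_spaceCuspRing, ringKrullDim_spaceCuspRing]
    norm_num
  · rw [encard_SSFc_spaceCuspRing, ringKrullDim_spaceCuspRing]
    norm_num
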